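/- Let $G$ be a connected (finite-dimensional, real) Lie group with Lie algebra $\mathfrak g$, $K$ a closed subgroup with Lie algebra $\mathfrak k$, and $N=G/K$ the coset manifold, with projection $\pi:G\to N$, $\pi(a)=aK$. Suppose $N$ is reductive, i.e. fix a subspace $\mathfrak p\subset\mathfrak g$ with $\mathfrak g=\mathfrak k\oplus\mathfrak p$ and $\mathrm{Ad}(K)\mathfrak p\subset\mathfrak p$; write $X_{\mathfrak k}, X_{\mathfrak p}$ for the components of $X\in\mathfrak g$, and $l_a$ for the left translation of $G$ by $a$. *Connections.* For a reductive homogeneous space $L/Q$ with decomposition $\mathfrak l=\mathfrak q\oplus\mathfrak m$, base point $o=eQ$ and projection $\mathrm{pr}:L\to L/Q$, and for $Y\in\mathfrak m$, let $Y^\#$ be the smooth vector field near $o$ given by $Y^\#_{aQ}=d\,\mathrm{pr}(Y_a)$ for $a=\exp W$, $W\in\mathfrak m$ close to $0$, where $Y_a$ is the value at $a$ of the left invariant vector field $Y$. An $L$-invariant affine connection $\nabla$ on $L/Q$ has connection function $\alpha:\mathfrak m\times\mathfrak m\to\mathfrak m$ if $\nabla_{X^\#_o}Y^\#=\alpha(X,Y)$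 for all $X,Y\in\mathfrak m\cong T_o(L/Q)$. The canonical connection is the invariant connection with $\alpha=0$; the natural torsion-free connection is the invariant connection with $\alpha(X,Y)=\tfrac12[X,Y]_{\mathfrak m}$. Let $\nabla^N$ be the natural torsion-free connection of $N=G/K$, and let $\nabla^G$ be the canonical connection of $G\cong(G\times G)/\Delta G$, where $G\times G$ acts on $G$ by $(b,c)\cdot a=bac^{-1}$ with base point $e$, and $\mathfrak g\oplus\mathfrak g=\Delta\mathfrak g\oplus\{(X,-X)\mid X\in\mathfrak g\}$. *Affine submersions.* Let $f:(M,\nabla^M)\to(M',\nabla^{M'})$ be a smooth submersion between manifolds with affine connections, and $\mathcal H$ a smooth distribution on $M$ with $TM=\mathcal H\oplus\mathcal V$, $\mathcal V=\ker df$; superscripts $\mathcal H,\mathcal V$ denote components and a bar denotes the horizontal lift. Then $f$ is an affine submersion with horizontal distribution $\mathcal H$ if $(\nabla^M_{\bar X}\bar Z)^{\mathcal H}=\overline{\nabla^{M'}_XZ}$ for all smooth vector fields $X,Z$ on $M'$. Its fundamental tensor $\mathcal A$ is the tensor field with $\mathcal A(X,Y)=(\nabla^M_{X^{\mathcal H}}Y^{\mathcal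 H})^{\mathcal V}+(\nabla^M_{X^{\mathcal H}}Y^{\mathcal V})^{\mathcal H}$ for smooth vector fields $X,Y$ on $M$. *Claim.* The projection $\pi:(G,\nabla^G)\to(N,\nabla^N)$ is an affine submersion with horizontal distribution $\mathcal H^\pi(a)=dl_a(\mathfrak p)$, $a\in G$. Its fundamental tensor $\mathcal A^\pi$ satisfies $$\mathcal A^\pi(dl_aX,dl_aY)=dl_a\bigl(\tfrac12[X,Y]_{\mathfrak k}\bigr)\qquad(a\in G,\ X,Y\in\mathfrak p),$$ and in particular $\mathcal A^\pi$ restricted to $\mathcal H^\pi\times\mathcal H^\pi$ is alternating. -/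

import Mathlib

open scoped Manifold ContDiff Topology
open Bundle VectorField

noncomputable section

namespace AffineSubmersion

/-! ### Vector fields, Lie groups and their Lie algebras -/

section Manifold

variable {E : Type*} [NormedAddCommGroup E] [NormedSpace ℝ E]
  {H : Type*} [TopologicalSpace H] (I : ModelWithCorners ℝ E H)
  {M : Type*} [TopologicalSpace M] [ChartedSpace H M]

/-- The vector field `Z` is smooth on the set `U`. -/
def SmoothFieldOn [IsManifold I 1 M] (Z : Π x : M, TangentSpace I x) (U : Set M) : Prop :=
  ContMDiffOn I I.tangent ∞ (fun x ↦ (⟨x, Z x⟩ : TangentBundle I M)) U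

/-- The vector field `Z` is smooth, i.e. `Z ∈ 𝔛(M)`. -/
def SmoothField [IsManifold I 1 M] (Z : Π x : M, TangentSpace I x) : Prop :=
  ContMDiff I I.tangent ∞ (fun x ↦ (⟨x, Z x⟩ : TangentBundle I M))

end Manifold

section LieGroup

variable {E : Type*} [NormedAddCommGroup E] [NormedSpace ℝ E]
  {H : Type*} [TopologicalSpace H] (I : ModelWithCorners ℝ E H)
  {G : Type*} [TopologicalSpace G] [ChartedSpace H G] [Group G]

/-- The curve `γ` passes through the identity at time `0` with velocity `X`. -/
def HasVelocityAtOne (γ : ℝ → G) (X : GroupLieAlgebra I G) : Prop :=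
  γ 0 = 1 ∧ HasMFDerivAt 𝓘(ℝ) I γ 0 (ContinuousLinearMap.toSpanSingleton ℝ (X : E))

/-- `g = exp X`: `g` is the time-one value of the one-parameter subgroup with velocity `X`. -/
def IsExp (X : GroupLieAlgebra I G) (g : G) : Prop :=
  ∃ γ : ℝ → G, ContMDiff 𝓘(ℝ) I ∞ γ ∧ (∀ s t, γ (s + t) = γ s * γ t) ∧
    HasVelocityAtOne I γ X ∧ γ 1 = g

/-- The adjoint representation `Ad k = d(g ↦ k g k⁻¹)_e`. -/
def Ad (k : G) : GroupLieAlgebra I G →L[ℝ] GroupLieAlgebra I G :=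
  mfderiv I I (fun g : G ↦ k * g * k⁻¹) 1

/-- The Lie algebra `𝔨 = T_e K` of a closed subgroup `K`: the velocities at the identity of smooth
curves of `G` that stay in `K`. -/
def subgroupLieAlgebra [LieGroup I ∞ G] (K : Subgroup G) :
    Submodule ℝ (GroupLieAlgebra I G) where
  carrier := {X | ∃ γ : ℝ → G, ContMDiff 𝓘(ℝ) I ∞ γ ∧ (∀ t, γ t ∈ K) ∧ HasVelocityAtOne I γ X}
  zero_mem' := by
    refine ⟨fun _ ↦ 1, contMDiff_const, fun _ ↦ K.one_mem, rfl, ?_⟩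
    have h : (ContinuousLinearMap.toSpanSingleton ℝ (0 : E)) = 0 := by ext; simp
    exact h ▸ hasMFDerivAt_const (I := 𝓘(ℝ)) (I' := I) (1 : G) (0 : ℝ)
  add_mem' := by
    rintro X Y ⟨γ, hγ, hγK, hγ0, hγX⟩ ⟨δ, hδ, hδK, hδ0, hδY⟩
    refine ⟨fun t ↦ γ t * δ t, hγ.mul hδ, fun t ↦ K.mul_mem (hγK t) (hδK t), by simp [hγ0, hδ0], ?_⟩
    have hm : HasMFDerivAt (I.prod I) I (fun p : G × G ↦ p.1 * p.2) (γ 0, δ 0)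
        ((ContinuousLinearMap.fst ℝ E E) + (ContinuousLinearMap.snd ℝ E E)) := by
      rw [hγ0, hδ0]
      have hd : MDifferentiableAt (I.prod I) I (fun p : G × G ↦ p.1 * p.2) (1, 1) :=
        (contMDiff_mul I ∞).mdifferentiableAt (by simp)
      have h := hd.hasMFDerivAt
      rw [mfderiv_prod_eq_add hd] at h
      have h1 : mfderiv (I.prod I) I (fun z : G × G ↦ z.1 * 1) ((1 : G), (1 : G)) =
          ContinuousLinearMap.fst ℝ E E := by
        exact ((hasMFDerivAt_fst (I := I) (I' := I) ((1 : G), (1 : G))).congr_of_eventuallyEq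
          (.of_forall fun z ↦ mul_one z.1)).mfderiv
      have h2 : mfderiv (I.prod I) I (fun z : G × G ↦ 1 * z.2) ((1 : G), (1 : G)) =
          ContinuousLinearMap.snd ℝ E E := by
        exact ((hasMFDerivAt_snd (I := I) (I' := I) ((1 : G), (1 : G))).congr_of_eventuallyEq
          (.of_forall fun z ↦ one_mul z.2)).mfderiv
      exact h1 ▸ h2 ▸ h
    have h := hm.comp (0 : ℝ) (hγX.prodMk hδY)
    have e : ((ContinuousLinearMap.fst ℝ E E) + (ContinuousLinearMap.snd ℝ E E)).comp
        ((ContinuousLinearMap.toSpanSingleton ℝ (X : E)).prod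
          (ContinuousLinearMap.toSpanSingleton ℝ (Y : E))) =
        ContinuousLinearMap.toSpanSingleton ℝ ((X : E) + (Y : E)) := by
      refine ContinuousLinearMap.ext fun t ↦ ?_
      exact (smul_add t (X : E) (Y : E)).symm
    exact e ▸ h
  smul_mem' := by
    rintro c X ⟨γ, hγ, hγK, hγ0, hγX⟩
    refine ⟨fun t ↦ γ (c * t), hγ.comp (contMDiff_const.mul contMDiff_id),
      fun t ↦ hγK _, by simp [hγ0], ?_⟩
    have hc : HasMFDerivAt 𝓘(ℝ) 𝓘(ℝ) (fun t : ℝ ↦ c * t) 0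
        (ContinuousLinearMap.toSpanSingleton ℝ c) := by
      have := ((hasDerivAt_id (0 : ℝ)).const_mul c).hasFDerivAt.hasMFDerivAt
      simpa using! this
    have hγ' : HasMFDerivAt 𝓘(ℝ) I γ (c * 0) (ContinuousLinearMap.toSpanSingleton ℝ (X : E)) := by
      rw [mul_zero]
      exact hγX
    have h := hγ'.comp (0 : ℝ) hc
    have e : (ContinuousLinearMap.toSpanSingleton ℝ (X : E)).comp
        (ContinuousLinearMap.toSpanSingleton ℝ c) =
        ContinuousLinearMap.toSpanSingleton ℝ (c • (X : E)) := by
      ext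
      simp
    exact e ▸ h

end LieGroup

/-! ### Invariant connections on homogeneous spaces

A homogeneous space is given here by a Lie group `L`, a manifold `M`, an action
`act : L → M → M` and a base point `o : M`; the projection `L → M` is the orbit map
`g ↦ act g o`. For `M = G ⧸ K` with `o = eK` the orbit map is `a ↦ aK`. For `M = G` with the action
`(b, c) · a = b a c⁻¹` of `G × G` and `o = e` this is `G ≅ (G × G) / ΔG`. -/

section Homogeneous

variable {E : Type*} [NormedAddCommGroup E] [NormedSpace ℝ E]
  {H : Type*} [TopologicalSpace H] (I : ModelWithCorners ℝ E H)
  {L : Type*} [TopologicalSpace L] [ChartedSpace H L] [Group L]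
  {E' : Type*} [NormedAddCommGroup E'] [NormedSpace ℝ E']
  {H' : Type*} [TopologicalSpace H'] (J : ModelWithCorners ℝ E' H')
  {M : Type*} [TopologicalSpace M] [ChartedSpace H' M]
  (act : L → M → M) (o : M)

/-- The differential at the identity of the projection `g ↦ act g o`, which identifies the
complement `𝔭` of the isotropy algebra with `T_o M` (recall that `act 1 o = o`). -/
def dproj : GroupLieAlgebra I L →L[ℝ] TangentSpace J o :=
  mfderiv I J (fun g : L ↦ act g o) 1

/-- The vector field `V` is a smooth representative near `o` of the local vector field `Y^#`,
defined by `Y^#_{a · o} = dπ(Y_a)` for all `a = exp W` with `W ∈ 𝔭` close to `0`, where `Y_a` is the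
value at `a` of the left invariant vector field `Y`. These conditions determine `V` near `o`. -/
def IsSharpField [IsManifold J 1 M] (𝔭 : Submodule ℝ (GroupLieAlgebra I L))
    (Y : GroupLieAlgebra I L) (V : Π x : M, TangentSpace J x) : Prop :=
  (∃ U ∈ 𝓝 o, SmoothFieldOn J V U) ∧
  ∀ᶠ W in 𝓝 (0 : GroupLieAlgebra I L), W ∈ 𝔭 → ∀ a : L, IsExp I W a →
    V (act a o) = mfderiv I J (fun g : L ↦ act g o) a (mulInvariantVectorField Y a)

/-- An `L`-invariant (smooth) affine connection:
`∇_{dL_a v} (dL_a Z) = dL_a (∇_v Z)`, written for the field `dL_a Z = Z'`, so that `Z` is the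
pullback of `Z'` by the translation by `a`. -/
structure IsInvariantConnection [IsManifold J 1 M]
    (cov : CovariantDerivative J E' (TangentSpace J : M → Type _)) : Prop where
  smooth : CovariantDerivative.ContMDiffCovariantDerivative cov ∞
  invariant : ∀ (a : L) (Z' : Π x : M, TangentSpace J x), SmoothField J Z' →
    ∀ (x : M) (v : TangentSpace J x),
      cov Z' (act a x) (mfderiv J J (act a) x v) =
        mfderiv J J (act a) x (cov (mpullback J J (act a) Z') x v)

/-- `cov` is the invariant connection with connection function `α`:
`∇_{X^#_o} Y^# = α(X, Y)` for `X, Y ∈ 𝔭`, where `𝔭` is identified with `T_o M`. -/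
structure IsInvariantConnectionWith [IsManifold J 1 M] (𝔭 : Submodule ℝ (GroupLieAlgebra I L))
    (α : 𝔭 → 𝔭 → 𝔭) (cov : CovariantDerivative J E' (TangentSpace J : M → Type _)) : Prop
    extends IsInvariantConnection J act cov where
  connection_function : ∀ Y : 𝔭, ∃ V : Π x : M, TangentSpace J x,
    IsSharpField I J act o 𝔭 (Y : GroupLieAlgebra I L) V ∧
    ∀ X : 𝔭, cov V o (dproj I J act o X) = dproj I J act o (α X Y)

end Homogeneous

/-! ### The coset manifold and the two connections -/

section Coset

variable {E : Type*} [NormedAddCommGroup E] [NormedSpace ℝ E]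
  {H : Type*} [TopologicalSpace H] (I : ModelWithCorners ℝ E H)
  {G : Type*} [TopologicalSpace G] [ChartedSpace H G] [Group G]
  {E' : Type*} [NormedAddCommGroup E'] [NormedSpace ℝ E']
  {H' : Type*} [TopologicalSpace H'] (J : ModelWithCorners ℝ E' H')

/-- The smooth structure on `G ⧸ K` is that of the coset manifold: the (unique) one for which the
projection is smooth and has smooth local sections around every point. -/
structure IsCosetManifold (K : Subgroup G) [ChartedSpace H' (G ⧸ K)] : Prop where
  contMDiff_mk : ContMDiff I J ∞ (fun a : G ↦ (a : G ⧸ K))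
  exists_section : ∀ x : G ⧸ K, ∃ U ∈ 𝓝 x, ∃ s : G ⧸ K → G,
    ContMDiffOn J I ∞ s U ∧ ∀ y ∈ U, (s y : G ⧸ K) = y

/-- `𝔤 = 𝔨 ⊕ 𝔭` with `𝔭` invariant under `Ad(K)`. -/
structure IsReductive [LieGroup I ∞ G] (K : Subgroup G) (𝔭 : Submodule ℝ (GroupLieAlgebra I G)) :
    Prop where
  isCompl : IsCompl (subgroupLieAlgebra I K) 𝔭
  ad_mem : ∀ k ∈ K, ∀ X ∈ 𝔭, Ad I k X ∈ 𝔭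

variable {I} in
/-- The component `X_𝔨`. -/
def IsReductive.kPart [LieGroup I ∞ G] {K : Subgroup G} {𝔭 : Submodule ℝ (GroupLieAlgebra I G)}
    (h : IsReductive I K 𝔭) : GroupLieAlgebra I G →ₗ[ℝ] subgroupLieAlgebra I K :=
  Submodule.projectionOnto _ _ h.isCompl

variable {I} in
/-- The component `X_𝔭`. -/
def IsReductive.pPart [LieGroup I ∞ G] {K : Subgroup G} {𝔭 : Submodule ℝ (GroupLieAlgebra I G)}
    (h : IsReductive I K 𝔭) : GroupLieAlgebra I G →ₗ[ℝ] 𝔭 :=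
  Submodule.projectionOnto _ _ h.isCompl.symm

variable {I} in
/-- The natural torsion-free connection of the reductive homogeneous space `G ⧸ K`: the invariant
connection with connection function `α(X, Y) = ½ [X, Y]_𝔭`. -/
def IsNaturalTorsionFree [LieGroup I ∞ G] {K : Subgroup G}
    {𝔭 : Submodule ℝ (GroupLieAlgebra I G)} (h : IsReductive I K 𝔭)
    [ChartedSpace H' (G ⧸ K)] [IsManifold J 1 (G ⧸ K)]
    (cov : CovariantDerivative J E' (TangentSpace J : G ⧸ K → Type _)) : Prop :=
  IsInvariantConnectionWith I J (fun (a : G) (x : G ⧸ K) ↦ a • x) ((1 : G) : G ⧸ K) 𝔭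
    (fun X Y ↦ (1 / 2 : ℝ) • h.pPart ⁅(X : GroupLieAlgebra I G), (Y : GroupLieAlgebra I G)⁆) cov

/-- The subspace `{(X, -X) | X ∈ 𝔤}` of `𝔤 ⊕ 𝔤`, the Lie algebra of `G × G`. -/
def antidiagonal : Submodule ℝ (GroupLieAlgebra (I.prod I) (G × G)) :=
  LinearMap.range
    ((LinearMap.id.prod (-LinearMap.id) : E →ₗ[ℝ] E × E) :
      GroupLieAlgebra I G →ₗ[ℝ] GroupLieAlgebra (I.prod I) (G × G))

/-- The canonical connection of `G ≅ (G × G) / ΔG` (via `(a, b) ↦ a b⁻¹`): the connection invariant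
under the action `(b, c) · a = b a c⁻¹` with connection function `0` on `{(X, -X)}`. -/
def IsCanonicalConnection [LieGroup I ∞ G]
    (cov : CovariantDerivative I E (TangentSpace I : G → Type _)) : Prop :=
  IsInvariantConnectionWith (I.prod I) I (fun (p : G × G) (a : G) ↦ p.1 * a * p.2⁻¹) (1 : G)
    (antidiagonal I) (fun _ _ ↦ 0) cov

/-- The distribution `a ↦ dl_a(𝔭)` on `G`. -/
def leftDistribution (𝔭 : Submodule ℝ (GroupLieAlgebra I G)) (a : G) :
    Submodule ℝ (TangentSpace I a) :=
  𝔭.map (mfderiv I I (fun g : G ↦ a * g) 1 :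
    GroupLieAlgebra I G →L[ℝ] TangentSpace I a).toLinearMap

end Coset

/-! ### Affine submersions with horizontal distribution -/

section Submersion

variable {E : Type*} [NormedAddCommGroup E] [NormedSpace ℝ E]
  {H : Type*} [TopologicalSpace H] (I : ModelWithCorners ℝ E H)
  {M : Type*} [TopologicalSpace M] [ChartedSpace H M]
  {E' : Type*} [NormedAddCommGroup E'] [NormedSpace ℝ E']
  {H' : Type*} [TopologicalSpace H'] (J : ModelWithCorners ℝ E' H')
  {N : Type*} [TopologicalSpace N] [ChartedSpace H' N]
  (f : M → N) (𝓗 : Π a : M, Submodule ℝ (TangentSpace I a))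

/-- The vertical space `ker (df)_a`. -/
def vertical (a : M) : Submodule ℝ (TangentSpace I a) :=
  LinearMap.ker (mfderiv I J f a).toLinearMap

/-- `𝓗` has smooth local frames. -/
def IsSmoothDistribution [IsManifold I 1 M] : Prop :=
  ∀ a : M, ∃ U ∈ 𝓝 a, ∃ (n : ℕ) (F : Fin n → Π b : M, TangentSpace I b),
    (∀ i, SmoothFieldOn I (F i) U) ∧
    ∀ b ∈ U, LinearIndependent ℝ (fun i ↦ F i b) ∧
      Submodule.span ℝ (Set.range fun i ↦ F i b) = 𝓗 b

/-- `Zbar` is the horizontal lift of the vector field `Z`. -/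
def IsHorizontalLift (Z : Π x : N, TangentSpace J x) (Zbar : Π a : M, TangentSpace I a) : Prop :=
  ∀ a, Zbar a ∈ 𝓗 a ∧ mfderiv I J f a (Zbar a) = Z (f a)

section Projections

variable {I J f 𝓗} (hc : ∀ a, IsCompl (𝓗 a) (vertical I J f a))

/-- The horizontal component of a vector field. -/
def hor (Z : Π a : M, TangentSpace I a) (a : M) : TangentSpace I a :=
  Submodule.projectionOnto _ _ (hc a) (Z a)

/-- The vertical component of a vector field. -/
def ver (Z : Π a : M, TangentSpace I a) (a : M) : TangentSpace I a :=
  Submodule.projectionOnto _ _ (hc a).symm (Z a)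

/-- `A` is the fundamental tensor of the submersion: the tensor field with
`A_X Y = (∇_{X^𝓗} Y^𝓗)^𝓥 + (∇_{X^𝓗} Y^𝓥)^𝓗` for all smooth vector fields `X`, `Y`. -/
def IsFundamentalTensor [IsManifold I 1 M]
    (cov : CovariantDerivative I E (TangentSpace I : M → Type _))
    (A : Π a : M, TangentSpace I a →ₗ[ℝ] TangentSpace I a →ₗ[ℝ] TangentSpace I a) : Prop :=
  ∀ X Y : Π a : M, TangentSpace I a, SmoothField I X → SmoothField I Y → ∀ a,
    A a (X a) (Y a) =
      ver hc (fun b ↦ cov (hor hc Y) b (hor hc X b)) a +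
      hor hc (fun b ↦ cov (ver hc Y) b (hor hc X b)) a

end Projections

/-- `f : (M, ∇^M) → (N, ∇^N)` is an affine submersion with horizontal distribution `𝓗`: a smooth
submersion, together with a smooth distribution `𝓗` complementary to the vertical one, such that
the horizontal component of `∇^M_{Xbar} Zbar` is the horizontal lift of `∇^N_X Z`. -/
structure IsAffineSubmersion [IsManifold I 1 M] [IsManifold J 1 N]
    (covM : CovariantDerivative I E (TangentSpace I : M → Type _))
    (covN : CovariantDerivative J E' (TangentSpace J : N → Type _)) : Prop where
  contMDiff : ContMDiff I J ∞ f
  surjective : ∀ a, Function.Surjective (mfderiv I J f a)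
  smooth : IsSmoothDistribution I 𝓗
  isCompl : ∀ a, IsCompl (𝓗 a) (vertical I J f a)
  affine : ∀ (X Z : Π x : N, TangentSpace J x) (Xbar Zbar : Π a : M, TangentSpace I a),
    SmoothField J X → SmoothField J Z →
    IsHorizontalLift I J f 𝓗 X Xbar → IsHorizontalLift I J f 𝓗 Z Zbar →
    IsHorizontalLift I J f 𝓗 (fun x ↦ covN Z x (X x))
      (hor isCompl (fun a ↦ covM Zbar a (Xbar a)))

end Submersion

end AffineSubmersion

end

open AffineSubmersion

/-!
A vector field on `G` has the form `g ↦ dl_g (u g)` for a function `u : G → 𝔤`. The curve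
`t ↦ (exp tX, exp (-tX)) · e = exp 2tX` has initial velocity `2X`, and along it the left invariant
field `Y` is the projection of the left invariant field on `G × G` given by
`(½ Ad (exp tX) Y, -½ Ad (exp tX) Y)`. As the connection function vanishes, differentiating at
`t = 0` yields `∇_X Y = ½ [X, Y]` for the canonical connection, and the Leibniz rule gives
`∇_{dl_a X} (dl u) = dl_a (du (dl_a X) + ½ [X, u a])`.

For a horizontal lift, `u` and hence `du` take values in `𝔭`, so the horizontal component is
`dl_a (du (dl_a X) + ½ [X, u a]_𝔭)`. The same differentiation along `t ↦ exp tX · o` in `G ⧸ K`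
shows that `∇^N` is the projection of this expression. The vertical component for `𝔭`-valued `u` and
the horizontal one for `𝔨`-valued `u` no longer contain `du`; they are the two terms of the
fundamental tensor.
-/

noncomputable section

namespace AffineSubmersion

section Velocity

variable {E : Type*} [NormedAddCommGroup E] [NormedSpace ℝ E]
  {H : Type*} [TopologicalSpace H] {I : ModelWithCorners ℝ E H}
  {M : Type*} [TopologicalSpace M] [ChartedSpace H M]
  {E' : Type*} [NormedAddCommGroup E'] [NormedSpace ℝ E']
  {H' : Type*} [TopologicalSpace H'] {J : ModelWithCorners ℝ E' H'}
  {N : Type*} [TopologicalSpace N] [ChartedSpace H' N]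
  {γ : ℝ → M} {t : ℝ} {x : M} {v w : TangentSpace I x}

variable (I) in
/-- The curve `γ` passes through `x` at time `t` with velocity `v`. The point `x` is a separate
argument because `v` would otherwise have the type `TangentSpace I (γ t)`, in which `γ t` cannot be
rewritten. -/
def HasVelocityAt (γ : ℝ → M) (t : ℝ) (x : M) (v : TangentSpace I x) : Prop :=
  γ t = x ∧ HasMFDerivAt 𝓘(ℝ) I γ t (ContinuousLinearMap.toSpanSingleton ℝ (v : E))

theorem hasVelocityAt_const (x : M) (t : ℝ) : HasVelocityAt I (fun _ ↦ x) t x 0 :=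
  ⟨rfl, ContinuousLinearMap.toSpanSingleton_zero (R₁ := ℝ) (M₁ := E) ▸ hasMFDerivAt_const x t⟩

theorem hasVelocityAt_iff_hasDerivAt {γ : ℝ → E} {t : ℝ} {v : E} :
    HasVelocityAt 𝓘(ℝ, E) γ t (γ t) v ↔ HasDerivAt γ v t :=
  ⟨fun h ↦ hasDerivAt_iff_hasFDerivAt.2 h.2.hasFDerivAt,
    fun h ↦ ⟨rfl, (hasDerivAt_iff_hasFDerivAt.1 h).hasMFDerivAt⟩⟩

namespace HasVelocityAt

theorem unique (hv : HasVelocityAt I γ t x v) (hw : HasVelocityAt I γ t x w) : v = w := by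
  obtain ⟨rfl, hv⟩ := hv
  have h : ContinuousLinearMap.toSpanSingleton ℝ (v : E) =
    ContinuousLinearMap.toSpanSingleton ℝ (w : E) := hasMFDerivAt_unique hv hw.2
  exact ContinuousLinearMap.toSpanSingleton_inj.1 h

theorem comp {f : M → N} (hf : MDifferentiableAt I J f x) (h : HasVelocityAt I γ t x v) :
    HasVelocityAt J (fun s ↦ f (γ s)) t (f x) (mfderiv I J f x v) := by
  obtain ⟨rfl, h⟩ := h
  exact ⟨rfl, ContinuousLinearMap.comp_toSpanSingleton
    (mfderiv I J f (γ t) : E →L[ℝ] E') (v : E) ▸ hf.hasMFDerivAt.comp t h⟩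

theorem hasDerivAt_comp {F : Type*} [NormedAddCommGroup F] [NormedSpace ℝ F] {f : M → F}
    (hf : MDifferentiableAt I 𝓘(ℝ, F) f x) (h : HasVelocityAt I γ t x v) :
    HasDerivAt (fun s ↦ f (γ s)) (mvfderiv I f x v) t := by
  obtain ⟨rfl, h⟩ := h
  exact hasVelocityAt_iff_hasDerivAt.1 (comp hf ⟨rfl, h⟩)

theorem comp_real {φ : ℝ → ℝ} {s c : ℝ} (h : HasVelocityAt I γ (φ s) x v)
    (hφ : HasDerivAt φ c s) : HasVelocityAt I (fun r ↦ γ (φ r)) s x (c • v) :=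
  ⟨h.1, ContinuousLinearMap.toSpanSingleton_comp_toSpanSingleton (x := (v : E)) (c := c) ▸
    h.2.comp s (hasDerivAt_iff_hasFDerivAt.1 hφ).hasMFDerivAt⟩

theorem comp_neg (h : HasVelocityAt I γ 0 x v) : HasVelocityAt I (fun s ↦ γ (-s)) 0 x (-v) := by
  have h' : HasVelocityAt I γ (-0) x v := by rwa [neg_zero]
  exact neg_one_smul ℝ v ▸ h'.comp_real (hasDerivAt_neg 0)

theorem prodMk {δ : ℝ → N} {y : N} {u : TangentSpace J y} (h : HasVelocityAt I γ t x v)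
    (h' : HasVelocityAt J δ t y u) :
    HasVelocityAt (I.prod J) (fun s ↦ (γ s, δ s)) t (x, y) ((v, u) : E × E') := by
  have e : (ContinuousLinearMap.toSpanSingleton ℝ (v : E)).prod
      (ContinuousLinearMap.toSpanSingleton ℝ (u : E')) =
        ContinuousLinearMap.toSpanSingleton ℝ ((v : E), (u : E')) := by ext <;> simp
  exact ⟨Prod.ext h.1 h'.1, e ▸ h.2.prodMk h'.2⟩

end HasVelocityAt

end Velocity

theorem eventually_mem_baseSet {M F P : Type*} [TopologicalSpace M] [TopologicalSpace F]
    [TopologicalSpace P] {V : M → Type*} [TopologicalSpace (TotalSpace F V)]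
    [∀ x, TopologicalSpace (V x)] [FiberBundle F V] {f : P → M} {p₀ : P} (hf : ContinuousAt f p₀) :
    ∀ᶠ p in 𝓝 p₀, f p ∈ (trivializationAt F V (f p₀)).baseSet :=
  hf.eventually_mem
    ((trivializationAt F V _).open_baseSet.mem_nhds (mem_baseSet_trivializationAt F V _))

section Trivialization

variable {E : Type*} [NormedAddCommGroup E] [NormedSpace ℝ E]
  {H : Type*} [TopologicalSpace H] {I : ModelWithCorners ℝ E H}
  {M : Type*} [TopologicalSpace M] [ChartedSpace H M]
  {F : Type*} [NormedAddCommGroup F] [NormedSpace ℝ F]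
  {V : M → Type*} [TopologicalSpace (TotalSpace F V)]
  [∀ x, AddCommGroup (V x)] [∀ x, Module ℝ (V x)] [∀ x, TopologicalSpace (V x)]
  [FiberBundle F V] [VectorBundle ℝ F V]
  {E₁ : Type*} [NormedAddCommGroup E₁] [NormedSpace ℝ E₁]
  {H₁ : Type*} [TopologicalSpace H₁] {I₁ : ModelWithCorners ℝ E₁ H₁}
  {P : Type*} [TopologicalSpace P] [ChartedSpace H₁ P]

variable (F V) in
/-- The fibre at `y` of a vector bundle, read in the preferred trivialization at `x`; this is `0`
when `y` is not in the base set of that trivialization. -/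
abbrev fiberCoord (x y : M) : V y →L[ℝ] F :=
  (trivializationAt F V x).continuousLinearMapAt ℝ y

theorem fiberCoord_bijective {x y : M} (hy : y ∈ (trivializationAt F V x).baseSet) :
    Function.Bijective (fiberCoord F V x y) := by
  have h : ⇑(fiberCoord F V x y) = (trivializationAt F V x).continuousLinearEquivAt ℝ y hy :=
    Trivialization.coe_linearMapAt_of_mem _ hy
  exact h ▸ ((trivializationAt F V x).continuousLinearEquivAt ℝ y hy).bijective

theorem mdifferentiableAt_fiberCoord_comp {f : P → M} {W : Π p : P, V (f p)} {p₀ : P}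
    (hW : MDifferentiableAt I₁ (I.prod 𝓘(ℝ, F)) (fun p ↦ (⟨f p, W p⟩ : TotalSpace F V)) p₀) :
    MDifferentiableAt I₁ 𝓘(ℝ, F) (fun p ↦ fiberCoord F V (f p₀) (f p) (W p)) p₀ := by
  obtain ⟨hf, hW⟩ := (mdifferentiableAt_totalSpace I _).1 hW
  refine hW.congr_of_eventuallyEq ?_
  filter_upwards [eventually_mem_baseSet (F := F) (V := V) hf.continuousAt] with p hp
  rw [Trivialization.continuousLinearMapAt_apply, Trivialization.linearMapAt_apply, if_pos hp]

theorem mdifferentiableAt_fiberCoord {σ : Π x : M, V x} {x : M}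
    (hσ : MDifferentiableAt I (I.prod 𝓘(ℝ, F)) (fun y ↦ (⟨y, σ y⟩ : TotalSpace F V)) x) :
    MDifferentiableAt I 𝓘(ℝ, F) (fun y ↦ fiberCoord F V x y (σ y)) x :=
  mdifferentiableAt_fiberCoord_comp hσ

theorem mdifferentiableAt_of_clm_apply {C : Type*} [NormedAddCommGroup C] [NormedSpace ℝ C]
    [FiniteDimensional ℝ C] {A : P → C →L[ℝ] F} {p₀ : P}
    (hA : ∀ c, MDifferentiableAt I₁ 𝓘(ℝ, F) (fun p ↦ A p c) p₀) :
    MDifferentiableAt I₁ 𝓘(ℝ, C →L[ℝ] F) A p₀ := by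
  let b := Module.finBasis ℝ C
  have hsum : A = fun p ↦ ∑ i,
      ContinuousLinearMap.smulRightL ℝ C F (LinearMap.toContinuousLinearMap (b.coord i))
        (A p (b i)) := by
    ext p c
    conv_lhs => rw [← b.sum_repr c, map_sum]
    simp
  rw [hsum]
  have := MDifferentiableAt.sum (t := Finset.univ) fun i _ ↦
    (ContinuousLinearMap.smulRightL ℝ C F
      (LinearMap.toContinuousLinearMap (b.coord i))).mdifferentiableAt.comp p₀ (hA (b i))
  exact this.congr_of_eventuallyEq (.of_forall fun p ↦ by simp)

theorem mdifferentiableAt_of_mdifferentiableAt_frame {C : Type*} [NormedAddCommGroup C]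
    [NormedSpace ℝ C] [FiniteDimensional ℝ C] {f : P → M} {W : Π p : P, C →ₗ[ℝ] V (f p)}
    {ζ : P → C} {p₀ : P} (hW : ∀ᶠ p in 𝓝 p₀, Function.Bijective (W p))
    (hWc : ∀ c, MDifferentiableAt I₁ (I.prod 𝓘(ℝ, F))
      (fun p ↦ (⟨f p, W p c⟩ : TotalSpace F V)) p₀)
    (hζ : MDifferentiableAt I₁ (I.prod 𝓘(ℝ, F))
      (fun p ↦ (⟨f p, W p (ζ p)⟩ : TotalSpace F V)) p₀) :
    MDifferentiableAt I₁ 𝓘(ℝ, C) ζ p₀ := by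
  let A : P → C →L[ℝ] F := fun p ↦
    ((fiberCoord F V (f p₀) (f p)).toLinearMap ∘ₗ W p).toContinuousLinearMap
  have hA : MDifferentiableAt I₁ 𝓘(ℝ, C →L[ℝ] F) A p₀ :=
    mdifferentiableAt_of_clm_apply fun c ↦ mdifferentiableAt_fiberCoord_comp (hWc c)
  have hf : ContinuousAt f p₀ := ((mdifferentiableAt_totalSpace I _).1 hζ).1.continuousAt
  have hinv : ∀ᶠ p in 𝓝 p₀, (A p).IsInvertible := by
    filter_upwards [hW, eventually_mem_baseSet (F := F) (V := V) hf] with p hWp hp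
    exact ⟨(LinearEquiv.ofBijective (A p).toLinearMap
      ((fiberCoord_bijective hp).comp hWp)).toContinuousLinearEquiv, rfl⟩
  have hA' : MDifferentiableAt I₁ 𝓘(ℝ, F →L[ℝ] C) (fun p ↦ (A p).inverse) p₀ :=
    (hinv.self_of_nhds.contDiffAt_map_inverse.differentiableAt one_ne_zero).mdifferentiableAt.comp
      p₀ hA
  refine (hA'.clm_apply (mdifferentiableAt_fiberCoord_comp hζ)).congr_of_eventuallyEq ?_
  filter_upwards [hinv] with p hp
  exact (hp.inverse_apply_eq.2 rfl).symm

end Trivialization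

section CovariantDerivative

variable {E : Type*} [NormedAddCommGroup E] [NormedSpace ℝ E]
  {H : Type*} [TopologicalSpace H] {I : ModelWithCorners ℝ E H}
  {M : Type*} [TopologicalSpace M] [ChartedSpace H M]
  {F : Type*} [NormedAddCommGroup F] [NormedSpace ℝ F]
  {V : M → Type*} [TopologicalSpace (TotalSpace F V)]
  [∀ x, AddCommGroup (V x)] [∀ x, Module ℝ (V x)] [∀ x, TopologicalSpace (V x)]
  [FiberBundle F V] [VectorBundle ℝ F V]

variable (I F V) in
/-- The derivative of sections read in the preferred trivialization at `x`: the flat reference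
connection from which Christoffel symbols at `x` are measured. -/
def flatDerivative (x : M) (σ : Π y : M, V y) (y : M) : TangentSpace I y →L[ℝ] V y :=
  (trivializationAt F V x).symmL ℝ y ∘L mvfderiv I (fun z ↦ fiberCoord F V x z (σ z)) y

variable {ι : Type*} [Fintype ι] {x : M} {v : TangentSpace I x} {γ : ℝ → M}
  {σ : Π y : M, V y} {τ : ι → Π y : M, V y} {c : ι → ℝ → ℝ} {c' : ι → ℝ}

theorem flatDerivative_eq_sum_of_curve (hγ : HasVelocityAt I γ 0 x v)
    (hσ : MDifferentiableAt I (I.prod 𝓘(ℝ, F)) (fun y ↦ (⟨y, σ y⟩ : TotalSpace F V)) x)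
    (hτ : ∀ i, MDifferentiableAt I (I.prod 𝓘(ℝ, F)) (fun y ↦ (⟨y, τ i y⟩ : TotalSpace F V)) x)
    (hc : ∀ i, HasDerivAt (c i) (c' i) 0)
    (h : ∀ᶠ t in 𝓝 (0 : ℝ), σ (γ t) = ∑ i, c i t • τ i (γ t)) :
    flatDerivative I F V x σ x v =
      ∑ i, (c i 0 • flatDerivative I F V x (τ i) x v + c' i • τ i x) := by
  have hsymm (u : V x) : (trivializationAt F V x).symmL ℝ x (fiberCoord F V x x u) = u :=
    Trivialization.symmL_continuousLinearMapAt _ (mem_baseSet_trivializationAt F V x) u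
  have hderiv := HasDerivAt.fun_sum (u := Finset.univ) fun i _ ↦
    (hc i).smul (hγ.hasDerivAt_comp (mdifferentiableAt_fiberCoord (hτ i)))
  have heq : (fun t ↦ fiberCoord F V x (γ t) (σ (γ t))) =ᶠ[𝓝 0]
      fun t ↦ ∑ i, c i t • fiberCoord F V x (γ t) (τ i (γ t)) := by
    filter_upwards [h] with t ht
    simp only [ht, map_sum, map_smul]
  have hcoord := (hγ.hasDerivAt_comp (mdifferentiableAt_fiberCoord hσ)).unique
    (hderiv.congr_of_eventuallyEq heq)
  obtain rfl := hγ.1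
  simp only [flatDerivative, ContinuousLinearMap.comp_apply, hcoord, map_sum, map_add, map_smul,
    hsymm]

variable [∀ x, IsTopologicalAddGroup (V x)] [∀ x, ContinuousSMul ℝ (V x)]

theorem isCovariantDerivativeOn_flatDerivative (x : M) :
    IsCovariantDerivativeOn F (flatDerivative I F V x) {x} where
  add {σ σ' y} hσ hσ' hy := by
    obtain rfl : y = x := hy
    have h := mvfderiv_add (mdifferentiableAt_fiberCoord hσ) (mdifferentiableAt_fiberCoord hσ')
    rw [flatDerivative, flatDerivative, flatDerivative, ← ContinuousLinearMap.comp_add, ← h]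
    congr 2
    ext z
    simp
  leibniz {σ g y} hσ hg hy := by
    obtain rfl : y = x := hy
    have h := mvfderiv_smul hg (mdifferentiableAt_fiberCoord hσ)
    have hsmul : (fun z ↦ fiberCoord F V y z ((g • σ) z)) =
        g • fun z ↦ fiberCoord F V y z (σ z) := by
      ext z
      simp
    have hsymm : (trivializationAt F V y).symmL ℝ y (fiberCoord F V y y (σ y)) = σ y :=
      Trivialization.symmL_continuousLinearMapAt _ (mem_baseSet_trivializationAt F V y) _
    rw [flatDerivative, flatDerivative, hsmul, h]
    ext v
    simp only [ContinuousLinearMap.comp_apply, add_apply, smul_apply,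
      ContinuousLinearMap.smulRight_apply, map_add, map_smul, hsymm]

theorem exists_cov_eq_flatDerivative_add [FiniteDimensional ℝ F] [ContMDiffVectorBundle 1 F V I]
    (cov : CovariantDerivative I F V) (x : M) :
    ∃ Γ : V x →L[ℝ] TangentSpace I x →L[ℝ] V x, ∀ σ : Π y : M, V y,
      MDifferentiableAt I (I.prod 𝓘(ℝ, F)) (fun y ↦ (⟨y, σ y⟩ : TotalSpace F V)) x →
        cov σ x = flatDerivative I F V x σ x + Γ (σ x) := by
  have hcov := cov.isCovariantDerivativeOn (s := {x})
  refine ⟨hcov.difference (isCovariantDerivativeOn_flatDerivative x) x, fun σ hσ ↦ ?_⟩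
  rw [IsCovariantDerivativeOn.difference_apply hcov _ rfl hσ, add_sub_cancel]

theorem cov_eq_sum_of_curve [FiniteDimensional ℝ F] [ContMDiffVectorBundle 1 F V I]
    (cov : CovariantDerivative I F V) (hγ : HasVelocityAt I γ 0 x v)
    (hσ : MDifferentiableAt I (I.prod 𝓘(ℝ, F)) (fun y ↦ (⟨y, σ y⟩ : TotalSpace F V)) x)
    (hτ : ∀ i, MDifferentiableAt I (I.prod 𝓘(ℝ, F)) (fun y ↦ (⟨y, τ i y⟩ : TotalSpace F V)) x)
    (hc : ∀ i, HasDerivAt (c i) (c' i) 0)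
    (h : ∀ᶠ t in 𝓝 (0 : ℝ), σ (γ t) = ∑ i, c i t • τ i (γ t)) :
    cov σ x v = ∑ i, (c i 0 • cov (τ i) x v + c' i • τ i x) := by
  obtain ⟨Γ, hΓ⟩ := exists_cov_eq_flatDerivative_add cov x
  have hσx : σ x = ∑ i, c i 0 • τ i x := hγ.1 ▸ h.self_of_nhds
  simp only [hΓ _ hσ, hΓ _ (hτ _), add_apply, flatDerivative_eq_sum_of_curve hγ hσ hτ hc h, hσx,
    map_sum, map_smul, sum_apply, smul_apply, smul_add, ← Finset.sum_add_distrib]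
  exact Finset.sum_congr rfl fun i _ ↦ add_right_comm _ _ _

end CovariantDerivative

section SmoothField

variable {E : Type*} [NormedAddCommGroup E] [NormedSpace ℝ E]
  {H : Type*} [TopologicalSpace H] {I : ModelWithCorners ℝ E H}
  {M : Type*} [TopologicalSpace M] [ChartedSpace H M]

theorem SmoothField.mdifferentiableAt [IsManifold I 1 M] {Z : Π x : M, TangentSpace I x}
    (hZ : SmoothField I Z) (x : M) :
    MDifferentiableAt I I.tangent (fun y ↦ (⟨y, Z y⟩ : TangentBundle I M)) x :=
  ContMDiff.mdifferentiable hZ (by simp) x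

variable (I) in
/-- The tangent vectors at `y` in the coordinates of the preferred chart at `x`. -/
abbrev tangentCoord [IsManifold I 1 M] (x y : M) : TangentSpace I y →L[ℝ] E :=
  fiberCoord E (TangentSpace I : M → Type _) x y

theorem hasVelocityAt_of_isMIntegralCurve {γ : ℝ → M} {Z : Π x : M, TangentSpace I x}
    (h : IsMIntegralCurve γ Z) (t : ℝ) : HasVelocityAt I γ t (γ t) (Z (γ t)) :=
  ⟨rfl, ContinuousLinearMap.smulRight_one_eq_toSpanSingleton (R₁ := ℝ) (Z (γ t) : E) ▸ h t⟩

end SmoothField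

theorem contDiffOn_of_hasDerivAt {E : Type*} [NormedAddCommGroup E] [NormedSpace ℝ E]
    {w : E → E} {Ω : Set E} (hw : ContDiffOn ℝ ∞ w Ω) {u : ℝ → E} {s : Set ℝ} (hs : IsOpen s)
    (hu : ∀ t ∈ s, HasDerivAt u (w (u t)) t) (hmem : Set.MapsTo u s Ω) :
    ContDiffOn ℝ ∞ u s := by
  refine contDiffOn_infty.2 fun n ↦ ?_
  induction n with
  | zero => exact contDiffOn_zero.2 fun t ht ↦ (hu t ht).continuousAt.continuousWithinAt
  | succ n ih =>
    push_cast
    refine (contDiffOn_succ_iff_deriv_of_isOpen hs).2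
      ⟨fun t ht ↦ (hu t ht).differentiableAt.differentiableWithinAt, by simp, ?_⟩
    exact ((contDiffOn_infty.1 hw n).comp ih hmem).congr fun t ht ↦ (hu t ht).deriv

section IntegralCurve

variable {E : Type*} [NormedAddCommGroup E] [NormedSpace ℝ E]
  {H : Type*} [TopologicalSpace H] {I : ModelWithCorners ℝ E H}
  {M : Type*} [TopologicalSpace M] [ChartedSpace H M] [IsManifold I ∞ M]

theorem contDiffOn_tangentCoord_extChartAt_symm {Z : Π x : M, TangentSpace I x}
    (hZ : SmoothField I Z) (x : M) :
    ContDiffOn ℝ ∞ (fun y ↦ tangentCoord I x ((extChartAt I x).symm y)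
      (Z ((extChartAt I x).symm y))) (extChartAt I x).target := by
  have : IsManifold I (∞ + 1) M := ‹IsManifold I ∞ M›
  have hcoord : ContMDiffOn I 𝓘(ℝ, E) ∞ (fun y ↦ tangentCoord I x y (Z y))
      (chartAt H x).source := by
    refine (((trivializationAt E (TangentSpace I) x).contMDiffOn_section_iff (n := ∞) (IB := I)
      (chartAt H x).open_source subset_rfl).1 (ContMDiff.contMDiffOn hZ)).congr fun y hy ↦ ?_
    exact congrFun (Trivialization.coe_linearMapAt_of_mem _ hy) _
  exact contMDiffOn_iff_contDiffOn.1 (hcoord.comp (contMDiffOn_extChartAt_symm x) fun y hy ↦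
    extChartAt_source I x ▸ (extChartAt I x).map_target hy)

theorem contMDiff_of_isMIntegralCurve {γ : ℝ → M} {Z : Π x : M, TangentSpace I x}
    (h : IsMIntegralCurve γ Z) (hZ : SmoothField I Z) : ContMDiff 𝓘(ℝ) I ∞ γ := by
  intro t₀
  have hsource : IsOpen (γ ⁻¹' (chartAt H (γ t₀)).source) :=
    (chartAt H (γ t₀)).open_source.preimage h.continuous
  have hu : ContDiffOn ℝ ∞ (fun t ↦ extChartAt I (γ t₀) (γ t))
      (γ ⁻¹' (chartAt H (γ t₀)).source) := by
    refine contDiffOn_of_hasDerivAt (contDiffOn_tangentCoord_extChartAt_symm hZ (γ t₀)) hsource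
      (fun t ht ↦ ?_) fun t ht ↦ (extChartAt I (γ t₀)).map_source (by rwa [extChartAt_source])
    have hderiv := (hasVelocityAt_of_isMIntegralCurve h t).hasDerivAt_comp
      (mdifferentiableAt_extChartAt (I := I) ht)
    rw [(extChartAt I (γ t₀)).left_inv (by rwa [extChartAt_source])]
    convert! hderiv using 1
    exact DFunLike.congr_fun (TangentBundle.continuousLinearMapAt_trivializationAt ht) _
  rw [contMDiffAt_iff_target]
  exact ⟨h.continuous.continuousAt,
    (hu.contDiffAt (hsource.mem_nhds (mem_chart_source H (γ t₀)))).contMDiffAt⟩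

end IntegralCurve

theorem map_zero_eq_one_of_map_add {G : Type*} [Group G] {γ : ℝ → G}
    (h : ∀ s t, γ (s + t) = γ s * γ t) : γ 0 = 1 := by
  simpa using h 0 0

theorem map_neg_eq_inv_of_map_add {G : Type*} [Group G] {γ : ℝ → G}
    (h : ∀ s t, γ (s + t) = γ s * γ t) (t : ℝ) : γ (-t) = (γ t)⁻¹ := by
  rw [eq_inv_iff_mul_eq_one, ← h, neg_add_cancel, map_zero_eq_one_of_map_add h]

section InvariantFields

variable {E : Type*} [NormedAddCommGroup E] [NormedSpace ℝ E]
  {H : Type*} [TopologicalSpace H] {I : ModelWithCorners ℝ E H}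
  {G : Type*} [TopologicalSpace G] [ChartedSpace H G] [Group G]

theorem isExp_smul {γ : ℝ → G} {X : GroupLieAlgebra I G}
    (hγ : ContMDiff 𝓘(ℝ) I ∞ γ) (hadd : ∀ s t, γ (s + t) = γ s * γ t)
    (hX : HasVelocityAt I γ 0 1 X) (t : ℝ) : IsExp I (t • X) (γ t) := by
  refine ⟨fun s ↦ γ (t * s), hγ.comp (contMDiff_const.mul contMDiff_id), fun r s ↦ ?_, ?_,
    congrArg γ (mul_one t)⟩
  · exact (congrArg γ (mul_add t r s)).trans (hadd _ _)
  · have hX' : HasVelocityAt I γ (t * 0) 1 X := by rwa [mul_zero]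
    exact hX'.comp_real (hasDerivAt_const_mul t)

theorem mulInvariantVectorField_one (X : GroupLieAlgebra I G) :
    mulInvariantVectorField X (1 : G) = X := by
  have h : (fun g : G ↦ 1 * g) = id := funext one_mul
  rw [mulInvariantVectorField, h, mfderiv_id]
  rfl

variable [LieGroup I ∞ G]

theorem lieGroup_minSmoothness : LieGroup I (minSmoothness ℝ 3) G := by
  rw [minSmoothness_of_isRCLikeNormedField]
  exact LieGroup.of_le (n := ∞) (WithTop.coe_le_coe.2 le_top)

theorem mdifferentiable_mul_left (a : G) : MDifferentiable I I (fun g : G ↦ a * g) :=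
  (contMDiff_mul_left (I := I) (n := ∞)).mdifferentiable (by simp)

theorem HasVelocityAt.mul_left {γ : ℝ → G} {t : ℝ} {X : GroupLieAlgebra I G}
    (h : HasVelocityAt I γ t 1 X) (a : G) :
    HasVelocityAt I (fun s ↦ a * γ s) t a (mulInvariantVectorField X a) := by
  have ha := h.comp (mdifferentiable_mul_left (I := I) a 1)
  exact ⟨ha.1.trans (mul_one a), ha.2⟩

theorem mfderiv_mul_left_mulInvariantVectorField (a b : G) (X : GroupLieAlgebra I G) :
    mfderiv I I (fun g : G ↦ a * g) b (mulInvariantVectorField X b) =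
      (mulInvariantVectorField X (a * b) : E) := by
  have hcomp := mfderiv_comp (1 : G) (mdifferentiable_mul_left (I := I) a (b * 1))
    (mdifferentiable_mul_left (I := I) b 1)
  have hassoc : (fun g ↦ a * g) ∘ (fun g ↦ b * g) = fun g : G ↦ a * b * g :=
    funext fun g ↦ (mul_assoc a b g).symm
  rw [hassoc, mul_one] at hcomp
  exact (DFunLike.congr_fun hcomp X).symm

theorem smoothField_mulInvariantVectorField (X : GroupLieAlgebra I G) :
    SmoothField I (mulInvariantVectorField X : Π g : G, TangentSpace I g) := by
  -- `X_g` is the image of `(0_g, X) ∈ T_g G × T_e G` under the tangent map of the multiplication.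
  have hpair : ContMDiff I (I.tangent.prod I.tangent) ∞ (fun g : G ↦
      ((⟨g, 0⟩, ⟨1, X⟩) : TangentBundle I G × TangentBundle I G)) :=
    (contMDiff_zeroSection ℝ (TangentSpace I : G → Type _)).prodMk contMDiff_const
  have htangent := ((contMDiff_mul I (G := G) ∞).contMDiff_tangentMap le_rfl).comp
    (contMDiff_equivTangentBundleProd_symm.comp hpair)
  refine htangent.congr fun g ↦ ?_
  have hmul : MDifferentiableAt (I.prod I) I (fun p : G × G ↦ p.1 * p.2) (g, 1) :=
    (contMDiff_mul I ∞).mdifferentiableAt (by simp)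
  refine TotalSpace.ext (mul_one g).symm (heq_of_eq ?_)
  have hpartial := mfderiv_prod_eq_add_apply (v := (((0 : E), (X : E)) :
    TangentSpace (I.prod I) ((g, 1) : G × G))) hmul
  refine Eq.trans ?_ hpartial.symm
  have hzero (A B : E →L[ℝ] E) (v : E) : B v = A 0 + B v := by rw [map_zero, zero_add]
  exact hzero (mfderiv I I (fun z : G ↦ z * 1) g) (mfderiv I I (fun z : G ↦ g * z) 1) X

theorem isMIntegralCurveOn_mul_left {γ : ℝ → G} {X : GroupLieAlgebra I G} {s : Set ℝ}
    (h : IsMIntegralCurveOn γ (mulInvariantVectorField X : Π g : G, TangentSpace I g) s) (a : G) :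
    IsMIntegralCurveOn (fun t ↦ a * γ t)
      (mulInvariantVectorField X : Π g : G, TangentSpace I g) s := by
  intro t ht
  have hcomp := (mdifferentiable_mul_left (I := I) a (γ t)).hasMFDerivAt.comp_hasMFDerivWithinAt t
    (h t ht)
  have hsmul (A : E →L[ℝ] E) (v w : E) (hw : A v = w) :
      A.comp ((1 : ℝ →L[ℝ] ℝ).smulRight v) = (1 : ℝ →L[ℝ] ℝ).smulRight w := by
    simp only [ContinuousLinearMap.smulRight_one_eq_toSpanSingleton,
      ContinuousLinearMap.comp_toSpanSingleton, hw]
  exact (hsmul _ _ _ (mfderiv_mul_left_mulInvariantVectorField a (γ t) X)) ▸ hcomp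

variable [BoundarylessManifold I G] [T2Space G]

theorem isMIntegralCurve_map_add {γ : ℝ → G} {X : GroupLieAlgebra I G}
    (hγ0 : γ 0 = 1)
    (h : IsMIntegralCurve γ (mulInvariantVectorField X : Π g : G, TangentSpace I g)) (s t : ℝ) :
    γ (s + t) = γ s * γ t := by
  have hmul : IsMIntegralCurve (fun t ↦ γ s * γ t)
      (mulInvariantVectorField X : Π g : G, TangentSpace I g) :=
    isMIntegralCurve_iff_isMIntegralCurveOn.2
      (isMIntegralCurveOn_mul_left (h.isMIntegralCurveOn _) (γ s))
  have heq := isMIntegralCurve_Ioo_eq_of_contMDiff_boundaryless (t₀ := 0)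
    ((smoothField_mulInvariantVectorField X).of_le (by simp)) (h.comp_add s) hmul (by simp [hγ0])
  simpa [add_comm] using congrFun heq t

theorem exists_isMIntegralCurve_mulInvariantVectorField [CompleteSpace E]
    (X : GroupLieAlgebra I G) :
    ∃ γ : ℝ → G, γ 0 = 1 ∧
      IsMIntegralCurve γ (mulInvariantVectorField X : Π g : G, TangentSpace I g) := by
  have hX : ContMDiff I I.tangent 1
      (fun g : G ↦ (⟨g, mulInvariantVectorField X g⟩ : TangentBundle I G)) :=
    (smoothField_mulInvariantVectorField X).of_le (by simp)
  obtain ⟨γ, hγ0, hγ⟩ := exists_isMIntegralCurveAt_of_contMDiffAt_boundaryless 0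
    (hX.contMDiffAt (x := 1))
  obtain ⟨ε, hε, hγ⟩ := isMIntegralCurveAt_iff'.1 hγ
  rw [Real.ball_eq_Ioo, zero_sub, zero_add] at hγ
  -- Left translates of `γ` give integral curves of one common lifetime `ε` through every point.
  exact exists_isMIntegralCurve_of_isMIntegralCurveOn hX hε
    (fun a ↦ ⟨fun t ↦ a * γ t, by simp only [hγ0, mul_one], isMIntegralCurveOn_mul_left hγ a⟩) 1

theorem exists_oneParameterSubgroup [CompleteSpace E] (X : GroupLieAlgebra I G) :
    ∃ γ : ℝ → G, ContMDiff 𝓘(ℝ) I ∞ γ ∧ (∀ s t, γ (s + t) = γ s * γ t) ∧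
      HasVelocityAt I γ 0 1 X := by
  obtain ⟨γ, hγ0, hγ⟩ := exists_isMIntegralCurve_mulInvariantVectorField X
  have hvel := hasVelocityAt_of_isMIntegralCurve hγ 0
  rw [hγ0, mulInvariantVectorField_one] at hvel
  exact ⟨γ, contMDiff_of_isMIntegralCurve hγ (smoothField_mulInvariantVectorField X),
    isMIntegralCurve_map_add hγ0 hγ, hvel⟩

end InvariantFields

section TangentCoord

variable {E : Type*} [NormedAddCommGroup E] [NormedSpace ℝ E]
  {H : Type*} [TopologicalSpace H] {I : ModelWithCorners ℝ E H}
  {M : Type*} [TopologicalSpace M] [ChartedSpace H M]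

section Bracket

variable [IsManifold I 1 M]

theorem tangentCoord_eq_mfderiv {x y : M} (hy : y ∈ (chartAt H x).source) :
    tangentCoord I x y = mfderiv I 𝓘(ℝ, E) (extChartAt I x) y :=
  TangentBundle.continuousLinearMapAt_trivializationAt hy

theorem tangentCoord_self (x : M) (v : TangentSpace I x) : tangentCoord I x x v = (v : E) :=
  (DFunLike.congr_fun (TangentBundle.continuousLinearMapAt_trivializationAt_eq_core
    (mem_chart_source H x)) v).trans
      ((tangentBundleCore I M).coordChange_self (achart H x) x (mem_chart_source H x) v)

theorem mpullbackWithin_extChartAt_symm_apply (x : M) (Z : Π y : M, TangentSpace I y) {y : E}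
    (hy : y ∈ (extChartAt I x).target) :
    mpullbackWithin 𝓘(ℝ, E) I (extChartAt I x).symm Z (Set.range I) y =
      tangentCoord I x ((extChartAt I x).symm y) (Z ((extChartAt I x).symm y)) := by
  have hsource : (extChartAt I x).symm y ∈ (chartAt H x).source :=
    extChartAt_source I x ▸ (extChartAt I x).map_target hy
  rw [mpullbackWithin_apply, tangentCoord_eq_mfderiv hsource]
  exact DFunLike.congr_fun (ContinuousLinearMap.inverse_eq
    (mfderivWithin_extChartAt_symm_comp_mfderiv_extChartAt hy)
    (mfderiv_extChartAt_comp_mfderivWithin_extChartAt_symm hy)) _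

theorem mvfderiv_tangentCoord {x : M} {Z : Π y : M, TangentSpace I y}
    (hZ : MDifferentiableAt I I.tangent (fun y ↦ (⟨y, Z y⟩ : TangentBundle I M)) x) :
    mvfderiv I (fun y ↦ tangentCoord I x y (Z y)) x =
      fderivWithin ℝ (mpullbackWithin 𝓘(ℝ, E) I (extChartAt I x).symm Z (Set.range I))
        (Set.range I) (extChartAt I x x) := by
  have hchart : mpullbackWithin 𝓘(ℝ, E) I (extChartAt I x).symm Z (Set.range I)
      =ᶠ[𝓝[Set.range I] extChartAt I x x]
        fun y ↦ tangentCoord I x ((extChartAt I x).symm y) (Z ((extChartAt I x).symm y)) := by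
    filter_upwards [extChartAt_target_mem_nhdsWithin x] with y hy
    exact mpullbackWithin_extChartAt_symm_apply x Z hy
  refine Eq.trans ?_ (hchart.fderivWithin_eq
    (mpullbackWithin_extChartAt_symm_apply x Z (mem_extChartAt_target x))).symm
  exact if_pos (mdifferentiableAt_fiberCoord hZ)

theorem tangentCoord_mlieBracket {x : M} {V W : Π y : M, TangentSpace I y}
    (hV : MDifferentiableAt I I.tangent (fun y ↦ (⟨y, V y⟩ : TangentBundle I M)) x)
    (hW : MDifferentiableAt I I.tangent (fun y ↦ (⟨y, W y⟩ : TangentBundle I M)) x) :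
    tangentCoord I x x (mlieBracket I V W x) =
      mvfderiv I (fun y ↦ tangentCoord I x y (W y)) x (V x) -
      mvfderiv I (fun y ↦ tangentCoord I x y (V y)) x (W x) := by
  let pull (Z : Π y : M, TangentSpace I y) : E → E :=
    mpullbackWithin 𝓘(ℝ, E) I (extChartAt I x).symm Z (Set.range I)
  have hpull (Z : Π y : M, TangentSpace I y) : pull Z (extChartAt I x x) = (Z x : E) := by
    refine (mpullbackWithin_extChartAt_symm_apply x Z (mem_extChartAt_target x)).trans ?_
    rw [extChartAt_to_inv, tangentCoord_self]
  have hdef : mlieBracket I V W x = (mfderiv I 𝓘(ℝ, E) (extChartAt I x) x).inverse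
      (lieBracketWithin ℝ (E := E) (pull V) (pull W) (Set.range I) (extChartAt I x x)) := by
    rw [← mlieBracketWithin_univ, mlieBracketWithin_apply, Set.preimage_univ, Set.univ_inter]
  have hbracket : lieBracketWithin ℝ (pull V) (pull W) (Set.range I) (extChartAt I x x) =
      mvfderiv I (fun y ↦ tangentCoord I x y (W y)) x (V x) -
        mvfderiv I (fun y ↦ tangentCoord I x y (V y)) x (W x) := by
    rw [mvfderiv_tangentCoord hV, mvfderiv_tangentCoord hW, lieBracketWithin_eq]
    simp only [hpull]
    rfl
  rw [tangentCoord_eq_mfderiv (mem_chart_source H x)]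
  exact ((isInvertible_mfderiv_extChartAt (mem_extChartAt_source x)).inverse_apply_eq.1
    hdef.symm).symm.trans hbracket

end Bracket

variable {W : Type*} [NormedAddCommGroup W] [NormedSpace ℝ W]

theorem hasDerivAt_fderiv_smul {F : W → E} (hF : ContDiffAt ℝ 2 F 0) (a q : W) :
    HasDerivAt (fun t : ℝ ↦ fderiv ℝ F (t • a) q) (fderiv ℝ (fderiv ℝ F) 0 a q) 0 := by
  have hF' : HasFDerivAt (fderiv ℝ F) (fderiv ℝ (fderiv ℝ F) 0) ((0 : ℝ) • a) := by
    rw [zero_smul]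
    exact ((hF.fderiv_right (m := 1) (by norm_num)).differentiableAt one_ne_zero).hasFDerivAt
  have hline : HasDerivAt (fun t : ℝ ↦ t • a) a 0 := by
    simpa using (hasDerivAt_id (0 : ℝ)).smul_const a
  have hcomp := hF'.comp_hasDerivAt 0 hline
  have happly := hcomp.clm_apply (hasDerivAt_const (0 : ℝ) q)
  rw [map_zero, add_zero] at happly
  exact happly

/-- `B` is the second derivative at `0` of `P` read in the chart at `P 0`. -/
theorem exists_symm_hasDerivAt_tangentCoord [IsManifold I 2 M] {P : W → M}
    (hP : ContMDiffAt 𝓘(ℝ, W) I 2 P 0) :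
    ∃ B : W →L[ℝ] W →L[ℝ] E, (∀ a q, B a q = B q a) ∧
      ∀ (a q : W) (δ : ℝ → M) (v : Π t, TangentSpace I (δ t)),
        (∀ᶠ t in 𝓝 0, HasVelocityAt I (fun s ↦ P (t • a + s • q)) 0 (δ t) (v t)) →
          HasDerivAt (fun t ↦ tangentCoord I (P 0) (δ t) (v t)) (B a q) 0 := by
  let F : W → E := fun p ↦ extChartAt I (P 0) (P p)
  have hF : ContDiffAt ℝ 2 F 0 := (contMDiffAt_extChartAt.comp 0 hP).contDiffAt
  refine ⟨fderiv ℝ (fderiv ℝ F) 0, hF.isSymmSndFDerivAt (by simp), fun a q δ v hv ↦ ?_⟩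
  refine (hasDerivAt_fderiv_smul hF a q).congr_of_eventuallyEq ?_
  have hray : Filter.Tendsto (fun t : ℝ ↦ t • a) (𝓝 0) (𝓝 0) := by
    have h : ContinuousAt (fun t : ℝ ↦ t • a) 0 := by fun_prop
    simpa only [ContinuousAt, zero_smul] using h
  filter_upwards [hv, hray.eventually (hF.eventually (by simp)),
    hray.eventually (hP.continuousAt.eventually_mem (chart_source_mem_nhds H (P 0)))]
    with t hvt hFt hPt
  have hend : P (t • a) = δ t := by simpa using hvt.1
  rw [tangentCoord_eq_mfderiv (hend ▸ hPt)]
  have hline : HasDerivAt (fun s : ℝ ↦ t • a + s • q) q 0 := by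
    simpa using ((hasDerivAt_id (0 : ℝ)).smul_const q).const_add (t • a)
  have hFt' : HasFDerivAt F (fderiv ℝ F (t • a)) (t • a + (0 : ℝ) • q) := by
    rw [zero_smul, add_zero]
    exact (hFt.differentiableAt two_ne_zero).hasFDerivAt
  have hderiv := hFt'.comp_hasDerivAt 0 hline
  exact (hvt.hasDerivAt_comp (mdifferentiableAt_extChartAt (hend ▸ hPt))).unique hderiv

end TangentCoord

section Adjoint

variable {E : Type*} [NormedAddCommGroup E] [NormedSpace ℝ E]
  {H : Type*} [TopologicalSpace H] {I : ModelWithCorners ℝ E H}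
  {G : Type*} [TopologicalSpace G] [ChartedSpace H G] [Group G] [LieGroup I ∞ G]
  {γ δ : ℝ → G} {t : ℝ} {X Y : GroupLieAlgebra I G}

theorem HasVelocityAt.mul (hγ : HasVelocityAt I γ t 1 X) (hδ : HasVelocityAt I δ t 1 Y) :
    HasVelocityAt I (fun s ↦ γ s * δ s) t 1 (X + Y) := by
  have hmul : MDifferentiableAt (I.prod I) I (fun p : G × G ↦ p.1 * p.2) (1, 1) :=
    (contMDiff_mul I ∞).mdifferentiableAt (by simp)
  let m : E × E →L[ℝ] E := mfderiv (I.prod I) I (fun p : G × G ↦ p.1 * p.2) (1, 1)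
  have hprod {γ δ : ℝ → G} {X Y : GroupLieAlgebra I G} (hγ : HasVelocityAt I γ t 1 X)
      (hδ : HasVelocityAt I δ t 1 Y) :
      HasVelocityAt I (fun s ↦ γ s * δ s) t 1 (m ((X : E), (Y : E))) :=
    have h := (hγ.prodMk hδ).comp hmul
    ⟨h.1.trans (mul_one 1), h.2⟩
  have hleft : m ((X : E), 0) = X := by
    have h := hprod hγ (hasVelocityAt_const 1 t)
    simp only [mul_one] at h
    exact h.unique hγ
  have hright : m (0, (Y : E)) = Y := by
    have h := hprod (hasVelocityAt_const 1 t) hδ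
    simp only [one_mul] at h
    exact h.unique hδ
  have hsplit (v w : E) : m (v, w) = m (v, 0) + m (0, w) := by simp [← map_add]
  have hadd : m ((X : E), (Y : E)) = (X + Y : E) :=
    (hsplit X Y).trans (congrArg₂ (· + ·) hleft hright)
  exact hadd ▸ hprod hγ hδ

theorem HasVelocityAt.inv (hγ : HasVelocityAt I γ t 1 X) :
    HasVelocityAt I (fun s ↦ (γ s)⁻¹) t 1 (-X) := by
  have h := hγ.comp ((contMDiff_inv I ∞).mdifferentiableAt (by simp))
  have hinv : HasVelocityAt I (fun s ↦ (γ s)⁻¹) t 1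
    (mfderiv I I (fun g : G ↦ g⁻¹) 1 X : E) := ⟨h.1.trans inv_one, h.2⟩
  have hzero := hγ.mul hinv
  simp only [mul_inv_cancel] at hzero
  exact neg_eq_of_add_eq_zero_right (hzero.unique (hasVelocityAt_const 1 t)) ▸ hinv

theorem HasVelocityAt.conj (hδ : HasVelocityAt I δ t 1 Y) (k : G) :
    HasVelocityAt I (fun s ↦ k * δ s * k⁻¹) t 1 (Ad I k Y) := by
  have hconj : ContMDiff I I ∞ (fun g : G ↦ k * g * k⁻¹) :=
    (contMDiff_const.mul contMDiff_id).mul contMDiff_const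
  have h := hδ.comp (hconj.mdifferentiableAt (by simp))
  exact ⟨h.1.trans (by simp), h.2⟩

theorem bracket_eq_sub_of_hasDerivAt_tangentCoord {x' y' : E} (hγ : HasVelocityAt I γ 0 1 X)
    (hδ : HasVelocityAt I δ 0 1 Y)
    (hy : HasDerivAt (fun t ↦ tangentCoord I 1 (γ t) (mulInvariantVectorField Y (γ t))) y' 0)
    (hx : HasDerivAt (fun t ↦ tangentCoord I 1 (δ t) (mulInvariantVectorField X (δ t))) x' 0) :
    (⁅X, Y⁆ : GroupLieAlgebra I G) = (y' - x' : E) := by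
  have hfield (Z : GroupLieAlgebra I G) : MDifferentiableAt I I.tangent
      (fun g ↦ (⟨g, mulInvariantVectorField Z g⟩ : TangentBundle I G)) 1 :=
    (smoothField_mulInvariantVectorField Z).mdifferentiableAt 1
  have h := tangentCoord_mlieBracket (hfield X) (hfield Y)
  rw [tangentCoord_self, mulInvariantVectorField_one, mulInvariantVectorField_one,
    (hγ.hasDerivAt_comp (mdifferentiableAt_fiberCoord (hfield Y))).unique hy,
    (hδ.hasDerivAt_comp (mdifferentiableAt_fiberCoord (hfield X))).unique hx] at h
  exact h

theorem hasDerivAt_Ad [BoundarylessManifold I G] [T2Space G] [CompleteSpace E]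
    (hγ : ContMDiff 𝓘(ℝ) I ∞ γ) (hX : HasVelocityAt I γ 0 1 X) (Y : GroupLieAlgebra I G) :
    HasDerivAt (fun t ↦ (Ad I (γ t) Y : E)) (⁅X, Y⁆ : GroupLieAlgebra I G) 0 := by
  obtain ⟨η, hη, -, hY⟩ := exists_oneParameterSubgroup Y
  have : IsManifold I 2 G :=
    IsManifold.of_le (n := ∞) (WithTop.coe_le_coe.2 (le_top : (2 : ℕ∞) ≤ ⊤))
  -- The derivatives of `Ad (γ t) Y` and of both fields in `⁅X, Y⁆ = dY(X) - dX(Y)` are second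
  -- derivatives of the map `(r, s, t) ↦ γ r * η s * (γ t)⁻¹`.
  have hP : ContMDiff 𝓘(ℝ, ℝ × ℝ × ℝ) I ∞
      (fun p : ℝ × ℝ × ℝ ↦ γ p.1 * η p.2.1 * (γ p.2.2)⁻¹) :=
    ((hγ.comp contDiff_fst.contMDiff).mul
      (hη.comp (contDiff_fst.comp contDiff_snd).contMDiff)).mul
        (hγ.comp (contDiff_snd.comp contDiff_snd).contMDiff).inv
  obtain ⟨B, hB, hderiv⟩ := exists_symm_hasDerivAt_tangentCoord (P := fun p : ℝ × ℝ × ℝ ↦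
    γ p.1 * η p.2.1 * (γ p.2.2)⁻¹)
    ((hP.of_le (WithTop.coe_le_coe.2 (le_top : (2 : ℕ∞) ≤ ⊤))).contMDiffAt)
  simp only [Prod.fst_zero, Prod.snd_zero, hX.1, hY.1, mul_one, inv_one] at hderiv
  have hYγ : HasDerivAt (fun t ↦ tangentCoord I 1 (γ t) (mulInvariantVectorField Y (γ t)))
      (B (1, 0, 0) (0, 1, 0)) 0 := by
    refine hderiv _ _ _ _ (.of_forall fun t ↦ ?_)
    simpa [hX.1] using hY.mul_left (γ t)
  have hXη : HasDerivAt (fun t ↦ tangentCoord I 1 (η t) (mulInvariantVectorField X (η t)))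
      (-B (0, 1, 0) (0, 0, 1)) 0 := by
    have h : HasDerivAt (fun t ↦ tangentCoord I 1 (η t) (mulInvariantVectorField (-X) (η t)))
        (B (0, 1, 0) (0, 0, 1)) 0 := by
      refine hderiv _ _ _ _ (.of_forall fun t ↦ ?_)
      simpa [hX.1] using hX.inv.mul_left (η t)
    refine h.fun_neg.congr_of_eventuallyEq (.of_forall fun t ↦ ?_)
    exact (neg_eq_iff_eq_neg.2 ((congrArg _ (map_neg _ X)).trans (map_neg _ _))).symm
  have hAd : HasDerivAt (fun t ↦ tangentCoord I 1 (1 : G) (Ad I (γ t) Y))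
      (B (1, 0, 1) (0, 1, 0)) 0 := by
    refine hderiv _ _ _ _ (.of_forall fun t ↦ ?_)
    simpa using hY.conj (γ t)
  have hbracket := bracket_eq_sub_of_hasDerivAt_tangentCoord hX hY hYγ hXη
  have hsum : B (1, 0, 0) (0, 1, 0) - -B (0, 1, 0) (0, 0, 1) = B (1, 0, 1) (0, 1, 0) := by
    rw [sub_neg_eq_add, hB (0, 1, 0), ← add_apply, ← map_add]
    simp
  simp only [tangentCoord_self] at hAd
  exact (hbracket.trans hsum) ▸ hAd

end Adjoint

theorem mem_of_hasDerivAt {F : Type*} [NormedAddCommGroup F] [NormedSpace ℝ F]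
    [FiniteDimensional ℝ F] {S : Submodule ℝ F} {c : ℝ → F} {c' : F} {t : ℝ}
    (hc : HasDerivAt c c' t) (hS : ∀ s, c s ∈ S) : c' ∈ S :=
  S.closed_of_finiteDimensional.mem_of_tendsto (hasDerivAt_iff_tendsto_slope.1 hc)
    (.of_forall fun _ ↦ S.smul_mem _ (S.sub_mem (hS _) (hS _)))

section ConnectionFunction

variable {E : Type*} [NormedAddCommGroup E] [NormedSpace ℝ E]
  {H : Type*} [TopologicalSpace H] {I : ModelWithCorners ℝ E H}
  {L : Type*} [TopologicalSpace L] [ChartedSpace H L] [Group L]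
  {E' : Type*} [NormedAddCommGroup E'] [NormedSpace ℝ E']
  {H' : Type*} [TopologicalSpace H'] {J : ModelWithCorners ℝ E' H'}
  {M : Type*} [TopologicalSpace M] [ChartedSpace H' M]
  {act : L → M → M} {o : M} {𝔭 : Submodule ℝ (GroupLieAlgebra I L)} {γ : ℝ → L}

theorem HasVelocityAt.orbit {X : GroupLieAlgebra I L} (hX : HasVelocityAt I γ 0 1 X)
    (hact : MDifferentiableAt I J (fun g : L ↦ act g o) 1) (ho : act 1 o = o) :
    HasVelocityAt J (fun t ↦ act (γ t) o) 0 o (dproj I J act o X) :=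
  have h := hX.comp hact
  ⟨h.1.trans ho, h.2⟩

section Sharp

variable [IsManifold J 1 M] {V : Π x : M, TangentSpace J x} {Y : GroupLieAlgebra I L}

theorem IsSharpField.mdifferentiableAt (hV : IsSharpField I J act o 𝔭 Y V) :
    MDifferentiableAt J J.tangent (fun x ↦ (⟨x, V x⟩ : TangentBundle J M)) o :=
  let ⟨⟨_, hU, hVU⟩, _⟩ := hV
  (ContMDiffOn.contMDiffAt hVU hU).mdifferentiableAt (by simp)

theorem IsSharpField.eventually_apply_eq {X : GroupLieAlgebra I L}
    (hV : IsSharpField I J act o 𝔭 Y V) (hγ : ContMDiff 𝓘(ℝ) I ∞ γ)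
    (hadd : ∀ s t, γ (s + t) = γ s * γ t) (hX : HasVelocityAt I γ 0 1 X) (hX𝔭 : X ∈ 𝔭) :
    ∀ᶠ t in 𝓝 (0 : ℝ), V (act (γ t) o) =
      mfderiv I J (fun g : L ↦ act g o) (γ t) (mulInvariantVectorField Y (γ t)) := by
  have hray : Filter.Tendsto (fun t : ℝ ↦ t • X) (𝓝 0) (𝓝 0) := by
    have h : ContinuousAt (fun t : ℝ ↦ t • X) 0 := by fun_prop
    simpa only [ContinuousAt, zero_smul] using h
  filter_upwards [hray.eventually hV.2] with t ht
  exact ht (𝔭.smul_mem t hX𝔭) _ (isExp_smul hγ hadd hX t)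

theorem IsSharpField.apply_base (hV : IsSharpField I J act o 𝔭 Y V) (ho : act 1 o = o) :
    V o = dproj I J act o Y := by
  have hone : IsExp I (0 : GroupLieAlgebra I L) 1 :=
    ⟨fun _ ↦ 1, contMDiff_const, fun _ _ ↦ (mul_one 1).symm, hasVelocityAt_const 1 0, rfl⟩
  have h := hV.2.self_of_nhds 𝔭.zero_mem 1 hone
  rw [mulInvariantVectorField_one] at h
  have hbase (x : M) (hx : x = o) : (V x : E') = V o := by rw [hx]
  exact (hbase _ ho).symm.trans h

end Sharp

variable [IsManifold J ∞ M] [FiniteDimensional ℝ E] [FiniteDimensional ℝ E']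
  {α : 𝔭 → 𝔭 → 𝔭} {cov : CovariantDerivative J E' (TangentSpace J : M → Type _)}

theorem IsInvariantConnectionWith.cov_dproj_of_curve
    (h : IsInvariantConnectionWith I J act o 𝔭 α cov)
    (hact : MDifferentiableAt I J (fun g : L ↦ act g o) 1) (ho : act 1 o = o)
    (hγ : ContMDiff 𝓘(ℝ) I ∞ γ) (hadd : ∀ s t, γ (s + t) = γ s * γ t)
    {X : 𝔭} (hX : HasVelocityAt I γ 0 1 (X : GroupLieAlgebra I L)) (hα : IsLinearMap ℝ (α X))
    {Z : Π x : M, TangentSpace J x}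
    (hZ : MDifferentiableAt J J.tangent (fun x ↦ (⟨x, Z x⟩ : TangentBundle J M)) o)
    {c : ℝ → 𝔭} {c' : GroupLieAlgebra I L}
    (hc : HasDerivAt (F := E) (fun t ↦ (c t : GroupLieAlgebra I L)) c' 0)
    (hZc : ∀ᶠ t in 𝓝 (0 : ℝ), Z (act (γ t) o) = mfderiv I J (fun g : L ↦ act g o) (γ t)
      (mulInvariantVectorField (c t : GroupLieAlgebra I L) (γ t))) :
    cov Z o (dproj I J act o X) = dproj I J act o (c' + α X (c 0)) := by
  have : FiniteDimensional ℝ (GroupLieAlgebra I L) := inferInstanceAs (FiniteDimensional ℝ E)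
  have : IsManifold J 2 M :=
    IsManifold.of_le (n := ∞) (WithTop.coe_le_coe.2 (le_top : (2 : ℕ∞) ≤ ⊤))
  let b := Module.finBasis ℝ 𝔭
  obtain ⟨q, hq⟩ := 𝔭.subtype.exists_leftInverse_of_injective 𝔭.ker_subtype
  let coord (i) : E →L[ℝ] ℝ :=
    LinearMap.toContinuousLinearMap (E := E) (b.coord i ∘ₗ q : GroupLieAlgebra I L →ₗ[ℝ] ℝ)
  have hcoord (i) (v : 𝔭) : coord i (v : GroupLieAlgebra I L) = b.repr v i :=
    congrArg (b.coord i) (DFunLike.congr_fun hq v)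
  obtain ⟨w, rfl⟩ : ∃ w : 𝔭, w = c' :=
    ⟨⟨c', mem_of_hasDerivAt (F := E) (S := 𝔭) hc fun t ↦ (c t).2⟩, rfl⟩
  have hsum (T : 𝔭 →ₗ[ℝ] E') (v : 𝔭) :
      ∑ i, coord i (v : GroupLieAlgebra I L) • T (b i) = T v := by
    simp only [hcoord, ← map_smul, ← map_sum, b.sum_repr]
  choose V hV hVcov using fun i ↦ h.connection_function (b i)
  let W (g : L) : 𝔭 →ₗ[ℝ] E' := (mfderiv I J (fun g : L ↦ act g o) g).toLinearMap ∘ₗ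
    (mfderiv I I (fun k : L ↦ g * k) 1).toLinearMap ∘ₗ 𝔭.subtype
  have hcurve : ∀ᶠ t in 𝓝 (0 : ℝ), Z (act (γ t) o) =
      ∑ i, coord i (c t : GroupLieAlgebra I L) • V i (act (γ t) o) := by
    filter_upwards [hZc, Filter.eventually_all.2 fun i ↦
      (hV i).eventually_apply_eq hγ hadd hX X.2] with t ht hVt
    simp only [ht, hVt]
    exact (hsum (W (γ t)) (c t)).symm
  have hderiv (i) : HasDerivAt (fun t ↦ coord i (c t : GroupLieAlgebra I L))
      (coord i (w : GroupLieAlgebra I L)) 0 := (coord i).hasFDerivAt.comp_hasDerivAt 0 hc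
  rw [cov_eq_sum_of_curve cov (hX.orbit hact ho) hZ (fun i ↦ (hV i).mdifferentiableAt)
    hderiv hcurve]
  let D : 𝔭 →ₗ[ℝ] E' := (dproj I J act o).toLinearMap ∘ₗ 𝔭.subtype
  have hbase (i) : V i o = D (b i) := (hV i).apply_base ho
  have hαD (i) : cov (V i) o (dproj I J act o X) = (D ∘ₗ hα.mk' _) (b i) := hVcov i X
  simp only [hbase, hαD, Finset.sum_add_distrib]
  have hfinal : (D ∘ₗ hα.mk' _) (c 0) + D w = D (w + α X (c 0)) := by
    rw [add_comm, map_add]; rfl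
  exact (congrArg₂ (· + ·) (hsum _ _) (hsum _ _)).trans hfinal

end ConnectionFunction

section LeftTranslation

variable {E : Type*} [NormedAddCommGroup E] [NormedSpace ℝ E]
  {H : Type*} [TopologicalSpace H] {I : ModelWithCorners ℝ E H}
  {G : Type*} [TopologicalSpace G] [ChartedSpace H G] [Group G] [LieGroup I ∞ G]

theorem mulInvariantVectorField_bijective (a : G) :
    Function.Bijective (fun X : GroupLieAlgebra I G ↦ mulInvariantVectorField X a) :=
  have : ContMDiffSMul I I ∞ G G := ⟨contMDiff_mul I ∞⟩
  ((Diffeomorph.smul I I ∞ a).mfderivToContinuousLinearEquiv (x := (1 : G)) (by simp)).bijective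

/-- The differential `(dl_a)_e` of the left translation by `a`, an isomorphism `𝔤 ≃ T_a G`. -/
def leftTranslation (a : G) : GroupLieAlgebra I G ≃ₗ[ℝ] TangentSpace I a :=
  LinearEquiv.ofBijective (mfderiv I I (fun g : G ↦ a * g) 1 :
    GroupLieAlgebra I G →L[ℝ] TangentSpace I a).toLinearMap (mulInvariantVectorField_bijective a)

theorem leftTranslation_apply (a : G) (X : GroupLieAlgebra I G) :
    leftTranslation a X = mulInvariantVectorField X a := rfl

theorem leftTranslation_apply_eq_sum {ι : Type*} [Fintype ι] (b : Module.Basis ι ℝ E) (g : G)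
    (v : E) : leftTranslation (I := I) g v =
      ∑ i, b.coord i v • mulInvariantVectorField (I := I) (b i) g := by
  let T : E →ₗ[ℝ] E := (leftTranslation (I := I) g).toLinearMap
  exact (congrArg T (b.sum_repr v).symm).trans (by simp only [map_sum, map_smul]; rfl)

variable [FiniteDimensional ℝ E] {a : G} {u : G → E}

theorem mdifferentiableAt_leftTranslation_apply_iff :
    MDifferentiableAt I I.tangent
      (fun g ↦ (⟨g, leftTranslation g (u g)⟩ : TangentBundle I G)) a ↔
    MDifferentiableAt I 𝓘(ℝ, E) u a := by
  have hfield (v : E) : MDifferentiableAt I I.tangent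
      (fun g ↦ (⟨g, mulInvariantVectorField v g⟩ : TangentBundle I G)) a :=
    (smoothField_mulInvariantVectorField v).mdifferentiableAt a
  refine ⟨fun h ↦ mdifferentiableAt_of_mdifferentiableAt_frame
    (C := E) (W := fun g ↦ (leftTranslation (I := I) g).toLinearMap)
    (.of_forall fun g ↦ (leftTranslation g).bijective) hfield h, fun h ↦ ?_⟩
  let b := Module.finBasis ℝ E
  simp only [leftTranslation_apply_eq_sum b]
  exact MDifferentiableAt.sum_section fun i _ ↦ MDifferentiableAt.smul_section
    ((b.coord i).toContinuousLinearMap.mdifferentiableAt.comp a h) (hfield (b i))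

theorem cov_leftTranslation_apply [BoundarylessManifold I G] [T2Space G]
    (cov : CovariantDerivative I E (TangentSpace I : G → Type _))
    (hu : MDifferentiableAt I 𝓘(ℝ, E) u a) (X : GroupLieAlgebra I G) :
    cov (fun g ↦ leftTranslation g (u g)) a (leftTranslation a X) =
      cov (mulInvariantVectorField (u a)) a (leftTranslation a X) +
        leftTranslation a (mvfderiv I u a (leftTranslation a X)) := by
  have : CompleteSpace E := FiniteDimensional.complete ℝ E
  have : IsManifold I 2 G :=
    IsManifold.of_le (n := ∞) (WithTop.coe_le_coe.2 (le_top : (2 : ℕ∞) ≤ ⊤))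
  obtain ⟨γ, -, -, hγ⟩ := exists_oneParameterSubgroup X
  have hγa := hγ.mul_left a
  let b := Module.finBasis ℝ E
  have hfield (v : E) : MDifferentiableAt I I.tangent
      (fun g ↦ (⟨g, mulInvariantVectorField v g⟩ : TangentBundle I G)) a :=
    (smoothField_mulInvariantVectorField v).mdifferentiableAt a
  have hexpand {σ : Π g : G, TangentSpace I g} {c : ℝ → E} {c' : E}
      (hσ : MDifferentiableAt I I.tangent (fun g ↦ (⟨g, σ g⟩ : TangentBundle I G)) a)
      (hc : HasDerivAt c c' 0) (hσc : ∀ t, σ (a * γ t) = leftTranslation (a * γ t) (c t)) :=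
    cov_eq_sum_of_curve cov hγa hσ (fun i ↦ hfield (b i))
      (fun i ↦ (b.coord i).toContinuousLinearMap.hasFDerivAt.comp_hasDerivAt 0 hc)
      (.of_forall fun t ↦ (hσc t).trans (leftTranslation_apply_eq_sum b _ _))
  have hu' := hexpand (mdifferentiableAt_leftTranslation_apply_iff.2 hu)
    (hγa.hasDerivAt_comp hu) fun t ↦ rfl
  have hconst := hexpand (hfield (u a)) (hasDerivAt_const (0 : ℝ) (u a)) fun t ↦ rfl
  simp only [map_zero, zero_smul, add_zero] at hconst
  rw [leftTranslation_apply, hu', hconst, Finset.sum_add_distrib]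
  refine congrArg₂ (· + ·) ?_ (leftTranslation_apply_eq_sum b a _).symm
  simp only [Function.comp_apply, hγa.1]

end LeftTranslation

section Canonical

variable {E : Type*} [NormedAddCommGroup E] [NormedSpace ℝ E]
  {H : Type*} [TopologicalSpace H] {I : ModelWithCorners ℝ E H}
  {G : Type*} [TopologicalSpace G] [ChartedSpace H G] [Group G]

theorem mem_antidiagonal (X : GroupLieAlgebra I G) :
    (((X : E), -(X : E)) : GroupLieAlgebra (I.prod I) (G × G)) ∈ antidiagonal (G := G) I :=
  ⟨X, rfl⟩

variable [LieGroup I ∞ G]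

theorem mdifferentiableAt_mul_mul_inv (p : G × G) :
    MDifferentiableAt (I.prod I) I (fun p : G × G ↦ p.1 * 1 * p.2⁻¹) p :=
  ((contMDiff_fst.mul contMDiff_const).mul contMDiff_snd.inv : ContMDiff (I.prod I) I ∞
    (fun p : G × G ↦ p.1 * 1 * p.2⁻¹)).mdifferentiableAt (by simp)

variable [BoundarylessManifold I G] [T2Space G]

section

variable [CompleteSpace E]

theorem Ad_one (Y : GroupLieAlgebra I G) : Ad I 1 Y = Y := by
  obtain ⟨η, -, -, hY⟩ := exists_oneParameterSubgroup Y
  have h := hY.conj 1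
  simp only [one_mul, inv_one, mul_one] at h
  exact h.unique hY

theorem Ad_mul_apply (k l : G) (Y : GroupLieAlgebra I G) :
    Ad I (k * l) Y = Ad I k (Ad I l Y) := by
  obtain ⟨η, -, -, hY⟩ := exists_oneParameterSubgroup Y
  have h := (hY.conj l).conj k
  simp only [← mul_assoc, mul_assoc _ l⁻¹, ← mul_inv_rev] at h
  exact (hY.conj (k * l)).unique h

theorem mfderiv_mul_mul_inv_mulInvariantVectorField (p : G × G) (U W : GroupLieAlgebra I G) :
    mfderiv (I.prod I) I (fun p : G × G ↦ p.1 * 1 * p.2⁻¹) p (mulInvariantVectorField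
      (((U : E), (W : E)) : GroupLieAlgebra (I.prod I) (G × G)) p) =
        mulInvariantVectorField (Ad I p.2 (U - W)) (p.1 * 1 * p.2⁻¹) := by
  obtain ⟨η, -, -, hU⟩ := exists_oneParameterSubgroup U
  obtain ⟨θ, -, -, hW⟩ := exists_oneParameterSubgroup W
  have hleft := ((hU.prodMk hW).mul_left p).comp (mdifferentiableAt_mul_mul_inv p)
  have hright := ((hU.mul hW.inv).conj p.2).mul_left (p.1 * 1 * p.2⁻¹)
  rw [← sub_eq_add_neg] at hright
  refine hleft.unique ?_
  convert! hright using 2 with s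
  simp [mul_assoc]

theorem dproj_antidiagonal (X : GroupLieAlgebra I G) :
    dproj (I.prod I) I (fun (p : G × G) (a : G) ↦ p.1 * a * p.2⁻¹) 1
      (((X : E), -(X : E)) : GroupLieAlgebra (I.prod I) (G × G)) = (2 : ℝ) • X := by
  obtain ⟨γ, -, hadd, hX⟩ := exists_oneParameterSubgroup X
  have h := (hX.prodMk hX.comp_neg).orbit (act := fun (p : G × G) (a : G) ↦ p.1 * a * p.2⁻¹)
    (mdifferentiableAt_mul_mul_inv 1) (by simp)
  simp only [mul_one, map_neg_eq_inv_of_map_add hadd, inv_inv] at h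
  exact (h.unique (hX.mul hX)).trans (two_smul ℝ (X : E)).symm

end

variable [FiniteDimensional ℝ E]
  {cov : CovariantDerivative I E (TangentSpace I : G → Type _)}

theorem IsCanonicalConnection.cov_one (h : IsCanonicalConnection I cov)
    (X Y : GroupLieAlgebra I G) :
    cov (mulInvariantVectorField Y) 1 X = (1 / 2 : ℝ) • ⁅X, Y⁆ := by
  have : CompleteSpace E := FiniteDimensional.complete ℝ E
  obtain ⟨γ, hγ, hadd, hX⟩ := exists_oneParameterSubgroup X
  have hinv (t) : γ (-t) = (γ t)⁻¹ := map_neg_eq_inv_of_map_add hadd t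
  let Z : GroupLieAlgebra I G → antidiagonal (G := G) I := fun Y ↦ ⟨_, mem_antidiagonal Y⟩
  have hAd : HasDerivAt (F := E) (fun t ↦ (1 / 2 : ℝ) • Ad I (γ t) Y) ((1 / 2 : ℝ) • ⁅X, Y⁆) 0 :=
    HasDerivAt.const_smul (F := E) (1 / 2 : ℝ) (hasDerivAt_Ad hγ hX Y)
  have hcov := h.cov_dproj_of_curve (γ := fun t ↦ (γ t, γ (-t))) (X := Z X)
    (c := fun t ↦ Z ((1 / 2 : ℝ) • Ad I (γ t) Y)) (Z := mulInvariantVectorField Y)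
    (mdifferentiableAt_mul_mul_inv 1) (by simp) (hγ.prodMk (hγ.comp contDiff_neg.contMDiff))
    (fun s t ↦ Prod.ext (hadd s t) ((congrArg γ (neg_add s t)).trans (hadd _ _)))
    (hX.prodMk hX.comp_neg) ⟨by simp, by simp⟩
    ((smoothField_mulInvariantVectorField Y).mdifferentiableAt 1)
    (HasDerivAt.prodMk (F := E) (G := E) hAd (HasDerivAt.neg (F := E) hAd)) ?_
  · let T : E →L[ℝ] E := cov (mulInvariantVectorField Y) 1
    have htwo : (2 : ℝ) • T X = (2 : ℝ) • ((1 / 2 : ℝ) • (⁅X, Y⁆ : GroupLieAlgebra I G) : E) :=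
      (map_smul T 2 X).symm.trans <| (congrArg T (dproj_antidiagonal X)).symm.trans <| hcov.trans <|
        (congrArg _ (add_zero _)).trans (dproj_antidiagonal _)
    exact smul_right_injective E two_ne_zero htwo
  · refine .of_forall fun t ↦ ?_
    have hAdY : Ad I (γ (-t)) ((1 / 2 : ℝ) • Ad I (γ t) Y - -((1 / 2 : ℝ) • Ad I (γ t) Y)) = Y := by
      rw [sub_neg_eq_add, ← two_smul ℝ, smul_smul, mul_one_div_cancel two_ne_zero, one_smul, hinv,
        ← Ad_mul_apply, inv_mul_cancel, Ad_one]
    have hdiff := mfderiv_mul_mul_inv_mulInvariantVectorField (γ t, γ (-t))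
      ((1 / 2 : ℝ) • Ad I (γ t) Y) (-((1 / 2 : ℝ) • Ad I (γ t) Y))
    rw [hAdY] at hdiff
    exact hdiff.symm

theorem IsCanonicalConnection.cov_mulInvariantVectorField (h : IsCanonicalConnection I cov)
    (X Y : GroupLieAlgebra I G) (a : G) :
    cov (mulInvariantVectorField Y) a (mulInvariantVectorField X a) =
      mulInvariantVectorField ((1 / 2 : ℝ) • ⁅X, Y⁆) a := by
  have : LieGroup I (minSmoothness ℝ 3) G := lieGroup_minSmoothness
  have hinv := h.invariant (a, 1) _ (smoothField_mulInvariantVectorField Y) 1 X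
  have hact : (fun x : G ↦ a * x * (1 : G)⁻¹) = fun x ↦ a * x := by simp
  simp only [hact] at hinv
  rw [mpullback_mulInvariantVectorField, h.cov_one] at hinv
  have hbase (b : G) (hb : b = a) (v : E) : (cov (mulInvariantVectorField Y) b v : E) =
      cov (mulInvariantVectorField Y) a v := by rw [hb]
  let D : (G → G) → E →L[ℝ] E := fun f ↦ mfderiv I I f 1
  have hD : D (fun x : G ↦ a * x * (1 : G)⁻¹) = D fun x : G ↦ a * x := congrArg D hact
  exact (hbase (a * 1 * 1⁻¹) (by simp) _).symm.trans
    ((congrArg (cov (mulInvariantVectorField Y) (a * 1 * 1⁻¹) : E → E)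
      (DFunLike.congr_fun hD X).symm).trans (hinv.trans (DFunLike.congr_fun hD _)))

end Canonical

section Coset

variable {E : Type*} [NormedAddCommGroup E] [NormedSpace ℝ E]
  {H : Type*} [TopologicalSpace H] {I : ModelWithCorners ℝ E H}
  {G : Type*} [TopologicalSpace G] [ChartedSpace H G] [Group G] {K : Subgroup G}
  {E' : Type*} [NormedAddCommGroup E'] [NormedSpace ℝ E']
  {H' : Type*} [TopologicalSpace H'] {J : ModelWithCorners ℝ E' H'}
  [ChartedSpace H' (G ⧸ K)]

theorem mem_subgroupLieAlgebra_of_contMDiffOn [LieGroup I ∞ G] {δ : ℝ → G} {T : Set ℝ}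
    {X : GroupLieAlgebra I G} (hT : T ∈ 𝓝 0) (hδ : ContMDiffOn 𝓘(ℝ) I ∞ δ T)
    (hδK : ∀ t ∈ T, δ t ∈ K) (hX : HasVelocityAt I δ 0 1 X) : X ∈ subgroupLieAlgebra I K := by
  obtain ⟨ε, hε, hεT⟩ := Metric.nhds_basis_ball.mem_iff.1 hT
  -- `φ` reparametrises the local curve to one defined for all times.
  let φ : ℝ → ℝ := fun t ↦ ε / 2 * Real.sin (t / (ε / 2))
  have hφT (t : ℝ) : T ∈ 𝓝 (φ t) := by
    refine Filter.mem_of_superset (Metric.isOpen_ball.mem_nhds ?_) hεT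
    rw [mem_ball_zero_iff, norm_mul, Real.norm_of_nonneg (half_pos hε).le]
    exact (mul_le_of_le_one_right (half_pos hε).le (Real.abs_sin_le_one _)).trans_lt
      (half_lt_self hε)
  have hφ : ContDiff ℝ ∞ φ :=
    contDiff_const.mul (Real.contDiff_sin.comp (contDiff_id.div_const _))
  have hφ' : HasDerivAt φ 1 0 := by
    have h := (((hasDerivAt_id (0 : ℝ)).div_const (ε / 2)).sin).const_mul (ε / 2)
    simpa [hε.ne'] using h
  have hX' : HasVelocityAt I δ (φ 0) 1 X := by simpa [φ] using hX
  have hvel := hX'.comp_real hφ'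
  rw [one_smul] at hvel
  exact ⟨δ ∘ φ, fun t ↦ (hδ.contMDiffAt (hφT t)).comp t hφ.contMDiff.contMDiffAt,
    fun t ↦ hδK _ (mem_of_mem_nhds (hφT t)), hvel⟩

namespace IsCosetManifold

theorem mdifferentiable_mk (hN : IsCosetManifold I J K) :
    MDifferentiable I J (fun a : G ↦ (a : G ⧸ K)) :=
  hN.contMDiff_mk.mdifferentiable (by simp)

variable [LieGroup I ∞ G]

theorem exists_section_through (hN : IsCosetManifold I J K) (a : G) :
    ∃ U ∈ 𝓝 (a : G ⧸ K), ∃ s : G ⧸ K → G,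
      ContMDiffOn J I ∞ s U ∧ (∀ y ∈ U, (s y : G ⧸ K) = y) ∧ s a = a := by
  obtain ⟨U, hU, s, hs, hsU⟩ := hN.exists_section a
  have hk : (s a)⁻¹ * a ∈ K := QuotientGroup.eq.1 (hsU a (mem_of_mem_nhds hU))
  refine ⟨U, hU, fun y ↦ s y * ((s a)⁻¹ * a), hs.mul contMDiffOn_const, fun y hy ↦ ?_, by simp⟩
  rw [QuotientGroup.mk_mul_of_mem _ hk, hsU y hy]

theorem contMDiff_smul (hN : IsCosetManifold I J K) (a : G) :
    ContMDiff J J ∞ (fun x : G ⧸ K ↦ a • x) := by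
  intro x
  obtain ⟨g, rfl⟩ := QuotientGroup.mk_surjective x
  obtain ⟨U, hU, s, hs, hsec, -⟩ := hN.exists_section_through g
  have h : ContMDiffAt J J ∞ (fun y : G ⧸ K ↦ ((a * s y : G) : G ⧸ K)) g :=
    hN.contMDiff_mk.contMDiffAt.comp _ (contMDiffAt_const.mul (hs.contMDiffAt hU))
  refine h.congr_of_eventuallyEq ?_
  filter_upwards [hU] with y hy using (congrArg (a • ·) (hsec y hy)).symm

theorem mdifferentiable_smul (hN : IsCosetManifold I J K) (a : G) :
    MDifferentiable J J (fun x : G ⧸ K ↦ a • x) :=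
  (hN.contMDiff_smul a).mdifferentiable (by simp)

theorem mfderiv_mk_surjective (hN : IsCosetManifold I J K) (a : G) :
    Function.Surjective (mfderiv I J (fun a : G ↦ (a : G ⧸ K)) a) := by
  obtain ⟨U, hU, s, hs, hsec, hsa⟩ := hN.exists_section_through a
  have hcomp := (hN.mdifferentiable_mk (s a)).hasMFDerivAt.comp (a : G ⧸ K)
    ((hs.contMDiffAt hU).mdifferentiableAt (by simp)).hasMFDerivAt
  have hid : HasMFDerivAt J J ((fun a : G ↦ (a : G ⧸ K)) ∘ s) (a : G ⧸ K)
      (ContinuousLinearMap.id ℝ E') :=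
    (hasMFDerivAt_id (a : G ⧸ K)).congr_of_eventuallyEq (Filter.eventually_of_mem hU hsec)
  have h := hasMFDerivAt_unique hcomp hid
  rw [hsa] at h
  exact fun w ↦ ⟨(mfderiv J I s (a : G ⧸ K) : E' →L[ℝ] E) w, DFunLike.congr_fun h w⟩

theorem isInvertible_mfderiv_smul (hN : IsCosetManifold I J K) (a : G) (x : G ⧸ K) :
    (mfderiv J J (fun x : G ⧸ K ↦ a • x) x).IsInvertible :=
  let d : (G ⧸ K) ≃ₘ^∞⟮J, J⟯ (G ⧸ K) :=
    { toEquiv := MulAction.toPerm a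
      contMDiff_toFun := hN.contMDiff_smul a
      contMDiff_invFun := hN.contMDiff_smul a⁻¹ }
  ⟨d.mfderivToContinuousLinearEquiv (by simp) x, rfl⟩

theorem mfderiv_mk_mulInvariantVectorField (hN : IsCosetManifold I J K) (a b : G)
    (X : GroupLieAlgebra I G) :
    (mfderiv I J (fun a : G ↦ (a : G ⧸ K)) (a * b) (mulInvariantVectorField X (a * b)) : E') =
      mfderiv J J (fun x : G ⧸ K ↦ a • x) (b : G ⧸ K)
        (mfderiv I J (fun a : G ↦ (a : G ⧸ K)) b (mulInvariantVectorField X b)) := by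
  have hleft := mfderiv_comp b (hN.mdifferentiable_mk (a * b))
    (mdifferentiable_mul_left (I := I) a b)
  have hright := mfderiv_comp b (hN.mdifferentiable_smul a (b : G ⧸ K)) (hN.mdifferentiable_mk b)
  rw [← mfderiv_mul_left_mulInvariantVectorField]
  exact DFunLike.congr_fun (hleft.symm.trans hright) (mulInvariantVectorField X b)

variable [BoundarylessManifold I G] [CompleteSpace E] [T2Space G]

theorem mem_subgroupLieAlgebra_iff (hN : IsCosetManifold I J K) (X : GroupLieAlgebra I G) :
    X ∈ subgroupLieAlgebra I K ↔ mfderiv I J (fun a : G ↦ (a : G ⧸ K)) 1 X = 0 := by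
  refine ⟨fun ⟨γ, _, hγK, (hX : HasVelocityAt I γ 0 1 X)⟩ ↦ ?_, fun hX0 ↦ ?_⟩
  · have hvel := hX.comp (hN.mdifferentiable_mk 1)
    have hconst : (fun t ↦ (γ t : G ⧸ K)) = fun _ ↦ ((1 : G) : G ⧸ K) :=
      funext fun t ↦ QuotientGroup.eq.2 (by simpa using hγK t)
    rw [hconst] at hvel
    exact hvel.unique (hasVelocityAt_const _ _)
  -- Correct a curve with velocity `X` by a section to a curve in `K`; the correction is of second
  -- order because `dπ X = 0`.
  · obtain ⟨γ, hγ, -, hX⟩ := exists_oneParameterSubgroup X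
    obtain ⟨U, hU, s, hs, hsec, hs1⟩ := hN.exists_section_through 1
    have hπγ : ContMDiff 𝓘(ℝ) J ∞ (fun t ↦ (γ t : G ⧸ K)) := hN.contMDiff_mk.comp hγ
    have hvel := hX.comp (hN.mdifferentiable_mk 1)
    rw [hX0] at hvel
    have hsvel := hvel.comp ((hs.contMDiffAt hU).mdifferentiableAt (by simp))
    rw [map_zero] at hsvel
    have hδX := (HasVelocityAt.inv (I := I) (X := 0) ⟨hsvel.1.trans hs1, hsvel.2⟩).mul hX
    rw [neg_zero, zero_add] at hδX
    have hT : (fun t ↦ (γ t : G ⧸ K)) ⁻¹' U ∈ 𝓝 0 :=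
      hπγ.continuous.continuousAt.preimage_mem_nhds (by simpa [hX.1] using hU)
    exact mem_subgroupLieAlgebra_of_contMDiffOn hT
      ((hs.comp hπγ.contMDiffOn subset_rfl).inv.mul hγ.contMDiffOn)
      (fun t ht ↦ QuotientGroup.eq.1 (hsec _ ht)) hδX

theorem mfderiv_mk_leftTranslation_eq_zero_iff (hN : IsCosetManifold I J K) (a : G)
    (X : GroupLieAlgebra I G) :
    mfderiv I J (fun a : G ↦ (a : G ⧸ K)) a (leftTranslation a X) = 0 ↔
      X ∈ subgroupLieAlgebra I K := by
  have h := hN.mfderiv_mk_mulInvariantVectorField a 1 X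
  rw [mulInvariantVectorField_one, mul_one] at h
  rw [hN.mem_subgroupLieAlgebra_iff, leftTranslation_apply,
    ← map_eq_zero_iff _ (hN.isInvertible_mfderiv_smul a ((1 : G) : G ⧸ K)).injective]
  exact ⟨fun h0 ↦ h.symm.trans h0, fun h0 ↦ h.trans h0⟩

theorem isCompl_leftDistribution_vertical (hN : IsCosetManifold I J K)
    {𝔭 : Submodule ℝ (GroupLieAlgebra I G)} (h𝔭 : IsReductive I K 𝔭) (a : G) :
    IsCompl (leftDistribution I 𝔭 a) (vertical I J (fun a : G ↦ (a : G ⧸ K)) a) := by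
  have hver : vertical I J (fun a : G ↦ (a : G ⧸ K)) a =
      (subgroupLieAlgebra I K).map (leftTranslation a).toLinearMap := by
    ext w
    obtain ⟨X, rfl⟩ := (leftTranslation a).surjective w
    rw [Submodule.mem_map_equiv, LinearEquiv.symm_apply_apply]
    exact hN.mfderiv_mk_leftTranslation_eq_zero_iff a X
  rw [hver]
  exact (Submodule.orderIsoMapComap (leftTranslation a)).isCompl h𝔭.isCompl.symm

end IsCosetManifold

end Coset

section NaturalTorsionFree

variable {E : Type*} [NormedAddCommGroup E] [NormedSpace ℝ E] [FiniteDimensional ℝ E]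
  {H : Type*} [TopologicalSpace H] {I : ModelWithCorners ℝ E H}
  {G : Type*} [TopologicalSpace G] [T2Space G] [ChartedSpace H G] [Group G] [LieGroup I ∞ G]
  [BoundarylessManifold I G] {K : Subgroup G} {𝔭 : Submodule ℝ (GroupLieAlgebra I G)}
  {h𝔭 : IsReductive I K 𝔭}
  {E' : Type*} [NormedAddCommGroup E'] [NormedSpace ℝ E'] [FiniteDimensional ℝ E']
  {H' : Type*} [TopologicalSpace H'] {J : ModelWithCorners ℝ E' H'}
  [ChartedSpace H' (G ⧸ K)] [IsManifold J ∞ (G ⧸ K)]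
  {cov : CovariantDerivative J E' (TangentSpace J : G ⧸ K → Type _)}
  {Z : Π x : G ⧸ K, TangentSpace J x} {z : G → E} {a : G}

theorem IsNaturalTorsionFree.cov_one (hN : IsCosetManifold I J K)
    (h : IsNaturalTorsionFree J h𝔭 cov) {X : GroupLieAlgebra I G} (hX𝔭 : X ∈ 𝔭)
    (hZ : MDifferentiableAt J J.tangent (fun x ↦ (⟨x, Z x⟩ : TangentBundle J (G ⧸ K)))
      ((1 : G) : G ⧸ K))
    (hz𝔭 : ∀ g, z g ∈ 𝔭) (hz : MDifferentiableAt I 𝓘(ℝ, E) z 1)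
    (hZz : ∀ g : G, Z g = mfderiv I J (fun a : G ↦ (a : G ⧸ K)) g (leftTranslation g (z g))) :
    cov Z ((1 : G) : G ⧸ K) (mfderiv I J (fun a : G ↦ (a : G ⧸ K)) 1 X) =
      mfderiv I J (fun a : G ↦ (a : G ⧸ K)) 1 (mvfderiv I z 1 X) +
        mfderiv I J (fun a : G ↦ (a : G ⧸ K)) 1
          ((1 / 2 : ℝ) • (h𝔭.pPart ⁅X, (z 1 : GroupLieAlgebra I G)⁆ : GroupLieAlgebra I G)) := by
  have : CompleteSpace E := FiniteDimensional.complete ℝ E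
  have : LieGroup I (minSmoothness ℝ 3) G := lieGroup_minSmoothness
  obtain ⟨γ, hγ, hadd, hX⟩ := exists_oneParameterSubgroup X
  have horbit : (fun g : G ↦ g • ((1 : G) : G ⧸ K)) = fun g : G ↦ (g : G ⧸ K) :=
    funext fun g ↦ congrArg _ (mul_one g)
  let D (f : G → G ⧸ K) (g : G) : E →L[ℝ] E' := mfderiv I J f g
  have hD (g : G) : D (fun g : G ↦ g • ((1 : G) : G ⧸ K)) g = D (fun g : G ↦ (g : G ⧸ K)) g :=
    congrArg (D · g) horbit
  have hlin : IsLinearMap ℝ fun Y : 𝔭 ↦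
      (1 / 2 : ℝ) • h𝔭.pPart ⁅X, (Y : GroupLieAlgebra I G)⁆ :=
    ⟨fun Y Y' ↦ by simp only [Submodule.coe_add, lie_add, map_add, smul_add],
      fun r Y ↦ by simp only [Submodule.coe_smul, lie_smul, map_smul, smul_comm r]⟩
  have hc : HasDerivAt (fun t ↦ z (γ t)) (mvfderiv I z 1 X) 0 := hX.hasDerivAt_comp hz
  have hpt {x y : G ⧸ K} (hxy : x = y) : (Z x : E') = Z y := by rw [hxy]
  have hcov := h.cov_dproj_of_curve (X := ⟨X, hX𝔭⟩) (by rw [horbit]; exact hN.mdifferentiable_mk 1)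
    (one_smul G _) hγ hadd hX hlin hZ (c := fun t ↦ ⟨z (γ t), hz𝔭 _⟩) hc
    (.of_forall fun t ↦ (hpt (congrFun horbit (γ t))).trans ((hZz (γ t)).trans
      (congrArg (fun L : E →L[ℝ] E' ↦ L (leftTranslation (γ t) (z (γ t)))) (hD (γ t)).symm)))
  have hγ0 : γ 0 = 1 := hX.1
  simp only [hγ0] at hcov
  exact (congrArg (fun L : E →L[ℝ] E' ↦ (cov Z ((1 : G) : G ⧸ K) (L X) : E')) (hD 1).symm).trans
    (hcov.trans ((congrArg (fun L : E →L[ℝ] E' ↦ L _) (hD 1)).trans (map_add (D _ 1) _ _)))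

theorem IsNaturalTorsionFree.cov_mk (hN : IsCosetManifold I J K)
    (h : IsNaturalTorsionFree J h𝔭 cov) {X : GroupLieAlgebra I G} (hX𝔭 : X ∈ 𝔭)
    (hZ : SmoothField J Z) (hz𝔭 : ∀ g, z g ∈ 𝔭) (hz : MDifferentiableAt I 𝓘(ℝ, E) z a)
    (hZz : ∀ g : G, Z g = mfderiv I J (fun a : G ↦ (a : G ⧸ K)) g (leftTranslation g (z g))) :
    cov Z (a : G ⧸ K) (mfderiv I J (fun a : G ↦ (a : G ⧸ K)) a (leftTranslation a X)) =
      mfderiv I J (fun a : G ↦ (a : G ⧸ K)) a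
          (leftTranslation a (mvfderiv I z a (leftTranslation a X))) +
        mfderiv I J (fun a : G ↦ (a : G ⧸ K)) a (leftTranslation a
          ((1 / 2 : ℝ) • (h𝔭.pPart ⁅X, (z a : GroupLieAlgebra I G)⁆ : GroupLieAlgebra I G))) := by
  have : CompleteSpace E' := FiniteDimensional.complete ℝ E'
  have : IsManifold J 2 (G ⧸ K) :=
    IsManifold.of_le (n := ∞) (WithTop.coe_le_coe.2 (le_top : (2 : ℕ∞) ≤ ⊤))
  have hinvertible := hN.isInvertible_mfderiv_smul a
  have hmk (Y : GroupLieAlgebra I G) :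
      (mfderiv I J (fun a : G ↦ (a : G ⧸ K)) a (leftTranslation a Y) : E') =
      mfderiv J J (fun x : G ⧸ K ↦ a • x) ((1 : G) : G ⧸ K)
        (mfderiv I J (fun a : G ↦ (a : G ⧸ K)) 1 Y) := by
    have h1 := hN.mfderiv_mk_mulInvariantVectorField a 1 Y
    rwa [mulInvariantVectorField_one, mul_one] at h1
  have hpullback : MDifferentiableAt J J.tangent
      (fun x ↦ (⟨x, mpullback J J (fun x : G ⧸ K ↦ a • x) Z x⟩ : TangentBundle J (G ⧸ K)))
      ((1 : G) : G ⧸ K) :=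
    MDifferentiableAt.mpullback_vectorField (n := ∞) (hZ.mdifferentiableAt _)
      (hN.contMDiff_smul a _) (hinvertible _) (WithTop.coe_le_coe.2 (le_top : (2 : ℕ∞) ≤ ⊤))
  have hz1 : MDifferentiableAt I 𝓘(ℝ, E) z (a * 1) := by rwa [mul_one]
  have hza : mvfderiv I (fun g ↦ z (a * g)) 1 X = mvfderiv I z a (leftTranslation a X) := by
    rw [show mvfderiv I (fun g ↦ z (a * g)) 1 = _ from
      mfderiv_comp (1 : G) hz1 (mdifferentiable_mul_left a 1), mul_one]
    rfl
  have hcov1 := h.cov_one hN hX𝔭 hpullback (z := fun g ↦ z (a * g)) (fun g ↦ hz𝔭 _)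
    (hz1.comp 1 (mdifferentiable_mul_left a 1)) fun g ↦ by
      rw [mpullback_apply]
      exact (hinvertible g).inverse_apply_eq.2
        ((hZz (a * g)).trans (hN.mfderiv_mk_mulInvariantVectorField a g _))
  have hinvariant := h.invariant a Z hZ ((1 : G) : G ⧸ K)
    (mfderiv I J (fun a : G ↦ (a : G ⧸ K)) 1 X)
  rw [hcov1, hza, mul_one, map_add] at hinvariant
  have hpt {x y : G ⧸ K} (hxy : x = y) (v : E') : (cov Z x v : E') = cov Z y v := by rw [hxy]
  exact ((congrArg (cov Z a : E' → E') (hmk X)).trans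
    (hpt (congrArg _ (mul_one a)) _).symm).trans
      (hinvariant.trans (congrArg₂ (fun v w : E' ↦ v + w) (hmk _) (hmk _)).symm)

end NaturalTorsionFree

section FundamentalForm

variable {E : Type*} [NormedAddCommGroup E] [NormedSpace ℝ E]
  {H : Type*} [TopologicalSpace H] {I : ModelWithCorners ℝ E H}
  {G : Type*} [TopologicalSpace G] [ChartedSpace H G] [Group G] [LieGroup I ∞ G]
  {K : Subgroup G} {𝔭 : Submodule ℝ (GroupLieAlgebra I G)} {X Y : GroupLieAlgebra I G}

namespace IsReductive

theorem kPart_add_pPart (h𝔭 : IsReductive I K 𝔭) (X : GroupLieAlgebra I G) :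
    (h𝔭.kPart X : GroupLieAlgebra I G) + h𝔭.pPart X = X :=
  Submodule.projection_add_projection_eq_self h𝔭.isCompl X

theorem kPart_of_mem (h𝔭 : IsReductive I K 𝔭) (hX : X ∈ 𝔭) : h𝔭.kPart X = 0 :=
  Submodule.projectionOnto_apply_of_mem_right h𝔭.isCompl hX

theorem pPart_of_mem (h𝔭 : IsReductive I K 𝔭) (hX : X ∈ 𝔭) : h𝔭.pPart X = X :=
  congrArg Subtype.val (Submodule.projectionOnto_apply_of_mem_left h𝔭.isCompl.symm hX)

theorem pPart_of_mem_subgroupLieAlgebra (h𝔭 : IsReductive I K 𝔭)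
    (hX : X ∈ subgroupLieAlgebra I K) : h𝔭.pPart X = 0 :=
  Submodule.projectionOnto_apply_of_mem_right h𝔭.isCompl.symm hX

variable [CompleteSpace E]

/-- The bilinear form `(X, Y) ↦ ½ [X_𝔭, Y_𝔭]_𝔨 + ½ [X_𝔭, Y_𝔨]_𝔭`, the value at the identity of the
fundamental tensor of the projection `G → G ⧸ K`. -/
def fundamentalForm (h𝔭 : IsReductive I K 𝔭) :
    GroupLieAlgebra I G →ₗ[ℝ] GroupLieAlgebra I G →ₗ[ℝ] GroupLieAlgebra I G :=
  have : LieGroup I (minSmoothness ℝ 3) G := lieGroup_minSmoothness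
  LinearMap.mk₂ ℝ (fun X Y ↦
    (1 / 2 : ℝ) • (h𝔭.kPart ⁅(h𝔭.pPart X : GroupLieAlgebra I G),
      (h𝔭.pPart Y : GroupLieAlgebra I G)⁆ : GroupLieAlgebra I G) +
    (1 / 2 : ℝ) • (h𝔭.pPart ⁅(h𝔭.pPart X : GroupLieAlgebra I G),
      (h𝔭.kPart Y : GroupLieAlgebra I G)⁆ : GroupLieAlgebra I G))
    (fun X X' Y ↦ by simp only [map_add, Submodule.coe_add, add_lie, smul_add]; abel)
    (fun c X Y ↦ by
      simp only [map_smul, Submodule.coe_smul, smul_lie, smul_add, smul_comm c (1 / 2 : ℝ)])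
    (fun X Y Y' ↦ by simp only [map_add, Submodule.coe_add, lie_add, smul_add]; abel)
    (fun c X Y ↦ by
      simp only [map_smul, Submodule.coe_smul, lie_smul, smul_add, smul_comm c (1 / 2 : ℝ)])

theorem fundamentalForm_of_mem (h𝔭 : IsReductive I K 𝔭) (hX : X ∈ 𝔭) (hY : Y ∈ 𝔭) :
    h𝔭.fundamentalForm X Y = (1 / 2 : ℝ) • (h𝔭.kPart ⁅X, Y⁆ : GroupLieAlgebra I G) := by
  have : LieGroup I (minSmoothness ℝ 3) G := lieGroup_minSmoothness
  simp only [fundamentalForm, LinearMap.mk₂_apply, h𝔭.pPart_of_mem hX, h𝔭.pPart_of_mem hY,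
    h𝔭.kPart_of_mem hY, ZeroMemClass.coe_zero, lie_zero, map_zero, smul_zero, add_zero]

/-- The left invariant tensor field on `G` with value `IsReductive.fundamentalForm` at the
identity. -/
def fundamentalTensor (h𝔭 : IsReductive I K 𝔭) (a : G) :
    TangentSpace I a →ₗ[ℝ] TangentSpace I a →ₗ[ℝ] TangentSpace I a :=
  (h𝔭.fundamentalForm.compl₁₂ (leftTranslation a).symm.toLinearMap
    (leftTranslation a).symm.toLinearMap).compr₂ (leftTranslation a).toLinearMap

theorem fundamentalTensor_leftTranslation (h𝔭 : IsReductive I K 𝔭) (a : G)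
    (X Y : GroupLieAlgebra I G) :
    h𝔭.fundamentalTensor a (leftTranslation a X) (leftTranslation a Y) =
      leftTranslation a (h𝔭.fundamentalForm X Y) := by
  simp [fundamentalTensor]

theorem fundamentalTensor_mulInvariantVectorField (h𝔭 : IsReductive I K 𝔭) (a : G)
    (hX : X ∈ 𝔭) (hY : Y ∈ 𝔭) :
    h𝔭.fundamentalTensor a (mulInvariantVectorField X a) (mulInvariantVectorField Y a) =
      mulInvariantVectorField ((1 / 2 : ℝ) • (h𝔭.kPart ⁅X, Y⁆ : GroupLieAlgebra I G)) a := by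
  rw [← h𝔭.fundamentalForm_of_mem hX hY]
  exact h𝔭.fundamentalTensor_leftTranslation a X Y

theorem fundamentalTensor_self (h𝔭 : IsReductive I K 𝔭) {a : G} {x : TangentSpace I a}
    (hx : x ∈ leftDistribution I 𝔭 a) : h𝔭.fundamentalTensor a x x = 0 := by
  have : LieGroup I (minSmoothness ℝ 3) G := lieGroup_minSmoothness
  obtain ⟨X, hX, rfl⟩ := hx
  refine (h𝔭.fundamentalTensor_mulInvariantVectorField a hX hX).trans ?_
  rw [lie_self, map_zero, ZeroMemClass.coe_zero, smul_zero]
  exact map_zero (leftTranslation a)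

end IsReductive

end FundamentalForm

section LeftInvariantComponents

variable {E : Type*} [NormedAddCommGroup E] [NormedSpace ℝ E] [FiniteDimensional ℝ E]
  {H : Type*} [TopologicalSpace H] {I : ModelWithCorners ℝ E H}
  {G : Type*} [TopologicalSpace G] [ChartedSpace H G] [Group G] [LieGroup I ∞ G]
  {𝔭 : Submodule ℝ (GroupLieAlgebra I G)}

theorem isSmoothDistribution_leftDistribution : IsSmoothDistribution I (leftDistribution I 𝔭) := by
  intro a
  have : FiniteDimensional ℝ (GroupLieAlgebra I G) := inferInstanceAs (FiniteDimensional ℝ E)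
  let b := Module.finBasis ℝ 𝔭
  refine ⟨Set.univ, Filter.univ_mem, _, fun i g ↦ leftTranslation g (b i), fun i ↦ ?_,
    fun g _ ↦ ⟨?_, ?_⟩⟩
  · exact (smoothField_mulInvariantVectorField (b i : GroupLieAlgebra I G)).contMDiffOn
  · exact (b.linearIndependent.map' 𝔭.subtype 𝔭.ker_subtype).map'
      (leftTranslation g).toLinearMap (LinearEquiv.ker _)
  · have hrange : (Set.range fun i ↦ leftTranslation g (b i : GroupLieAlgebra I G)) =
        (leftTranslation g).toLinearMap '' (𝔭.subtype '' Set.range b) := by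
      rw [← Set.range_comp, ← Set.range_comp]
      rfl
    rw [hrange, Submodule.span_image, Submodule.span_image, b.span_eq, Submodule.map_subtype_top]
    rfl

variable [BoundarylessManifold I G] [T2Space G] {u : G → E} {a : G}

theorem mvfderiv_leftTranslation_mem {S : Submodule ℝ (GroupLieAlgebra I G)}
    (hu : MDifferentiableAt I 𝓘(ℝ, E) u a) (hS : ∀ g, u g ∈ S) (X : GroupLieAlgebra I G) :
    mvfderiv I u a (leftTranslation a X) ∈ S := by
  have : CompleteSpace E := FiniteDimensional.complete ℝ E
  obtain ⟨γ, -, -, hX⟩ := exists_oneParameterSubgroup X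
  exact mem_of_hasDerivAt ((hX.mul_left a).hasDerivAt_comp hu) fun _ ↦ hS _

theorem IsCanonicalConnection.cov_leftTranslation_apply
    {cov : CovariantDerivative I E (TangentSpace I : G → Type _)} (h : IsCanonicalConnection I cov)
    (hu : MDifferentiableAt I 𝓘(ℝ, E) u a) (X : GroupLieAlgebra I G) :
    cov (fun g ↦ leftTranslation g (u g)) a (leftTranslation a X) =
      leftTranslation a (mvfderiv I u a (leftTranslation a X)) +
        leftTranslation a ((1 / 2 : ℝ) • (⁅X, u a⁆ : GroupLieAlgebra I G)) := by
  rw [AffineSubmersion.cov_leftTranslation_apply cov hu, add_comm]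
  exact congrArg _ (h.cov_mulInvariantVectorField X (u a) a)

end LeftInvariantComponents

section Projection

variable {E : Type*} [NormedAddCommGroup E] [NormedSpace ℝ E]
  {H : Type*} [TopologicalSpace H] {I : ModelWithCorners ℝ E H}
  {G : Type*} [TopologicalSpace G] [T2Space G] [ChartedSpace H G] [Group G] [LieGroup I ∞ G]
  [BoundarylessManifold I G] {K : Subgroup G} {𝔭 : Submodule ℝ (GroupLieAlgebra I G)}
  {E' : Type*} [NormedAddCommGroup E'] [NormedSpace ℝ E']
  {H' : Type*} [TopologicalSpace H'] {J : ModelWithCorners ℝ E' H'} [ChartedSpace H' (G ⧸ K)]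

namespace IsCosetManifold

section

variable [CompleteSpace E] {Z : Π a : G, TangentSpace I a} {a : G} {X : GroupLieAlgebra I G}

theorem hor_eq_leftTranslation (hN : IsCosetManifold I J K) (h𝔭 : IsReductive I K 𝔭)
    (hc : ∀ a : G, IsCompl (leftDistribution I 𝔭 a) (vertical I J (fun a : G ↦ (a : G ⧸ K)) a))
    (hX : Z a = leftTranslation a X) :
    hor hc Z a = leftTranslation a (h𝔭.pPart X : GroupLieAlgebra I G) := by
  have hk : leftTranslation a (h𝔭.kPart X : GroupLieAlgebra I G) ∈
      vertical I J (fun a : G ↦ (a : G ⧸ K)) a :=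
    (hN.mfderiv_mk_leftTranslation_eq_zero_iff a _).2 (h𝔭.kPart X).2
  have hp : leftTranslation a (h𝔭.pPart X : GroupLieAlgebra I G) ∈ leftDistribution I 𝔭 a :=
    Submodule.mem_map_of_mem (h𝔭.pPart X).2
  rw [hor, hX]
  conv_lhs => rw [← h𝔭.kPart_add_pPart X, map_add, map_add,
    Submodule.projectionOnto_apply_of_mem_right (hc a) hk,
    Submodule.projectionOnto_apply_of_mem_left (hc a) hp, zero_add]

theorem ver_eq_leftTranslation (hN : IsCosetManifold I J K) (h𝔭 : IsReductive I K 𝔭)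
    (hc : ∀ a : G, IsCompl (leftDistribution I 𝔭 a) (vertical I J (fun a : G ↦ (a : G ⧸ K)) a))
    (hX : Z a = leftTranslation a X) :
    ver hc Z a = leftTranslation a (h𝔭.kPart X : GroupLieAlgebra I G) := by
  have hsum : hor hc Z a + ver hc Z a = Z a :=
    Submodule.projection_add_projection_eq_self (hc a) (Z a)
  rw [hN.hor_eq_leftTranslation h𝔭 hc hX, hX, add_comm] at hsum
  rw [eq_sub_of_add_eq hsum, ← map_sub]
  exact congrArg _ (eq_sub_of_add_eq (h𝔭.kPart_add_pPart X)).symm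

theorem bijective_mfderiv_mk_leftTranslation (hN : IsCosetManifold I J K)
    (h𝔭 : IsReductive I K 𝔭) (a : G) :
    Function.Bijective (fun X : 𝔭 ↦ mfderiv I J (fun a : G ↦ (a : G ⧸ K)) a
      (leftTranslation a (X : GroupLieAlgebra I G))) := by
  let T : GroupLieAlgebra I G →ₗ[ℝ] TangentSpace J (a : G ⧸ K) :=
    (mfderiv I J (fun a : G ↦ (a : G ⧸ K)) a).toLinearMap ∘ₗ (leftTranslation a).toLinearMap
  have hker : LinearMap.ker T = subgroupLieAlgebra I K :=
    Submodule.ext (hN.mfderiv_mk_leftTranslation_eq_zero_iff a)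
  have hrange : LinearMap.range T = ⊤ :=
    LinearMap.range_eq_top.2 ((hN.mfderiv_mk_surjective a).comp (leftTranslation a).surjective)
  exact ((T.kerComplementEquivRange (hker ▸ h𝔭.isCompl.symm)).trans
    (LinearEquiv.ofTop _ hrange)).bijective

end

variable [FiniteDimensional ℝ E] {cov : CovariantDerivative I E (TangentSpace I : G → Type _)}
  {X : Π a : G, TangentSpace I a} {u : G → E} {a : G} {x : GroupLieAlgebra I G}

theorem hor_cov_leftTranslation (hN : IsCosetManifold I J K) (h𝔭 : IsReductive I K 𝔭)
    (hc : ∀ a : G, IsCompl (leftDistribution I 𝔭 a) (vertical I J (fun a : G ↦ (a : G ⧸ K)) a))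
    (hG : IsCanonicalConnection I cov) (hu : MDifferentiableAt I 𝓘(ℝ, E) u a)
    (hx : X a = leftTranslation a x) :
    hor hc (fun g ↦ cov (fun g ↦ leftTranslation g (u g)) g (X g)) a =
      leftTranslation a
          (h𝔭.pPart (mvfderiv I u a (leftTranslation a x)) : GroupLieAlgebra I G) +
        leftTranslation a ((1 / 2 : ℝ) • (h𝔭.pPart ⁅x, u a⁆ : GroupLieAlgebra I G)) := by
  have : CompleteSpace E := FiniteDimensional.complete ℝ E
  have hcov := (hG.cov_leftTranslation_apply hu x).trans
    (map_add (leftTranslation (I := I) a) _ _).symm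
  rw [← hx] at hcov
  have hadd (v w : GroupLieAlgebra I G) :
      leftTranslation a (h𝔭.pPart (v + (1 / 2 : ℝ) • w) : GroupLieAlgebra I G) =
        leftTranslation a (h𝔭.pPart v : GroupLieAlgebra I G) +
          leftTranslation a ((1 / 2 : ℝ) • (h𝔭.pPart w : GroupLieAlgebra I G)) := by
    rw [map_add, Submodule.coe_add, map_add, map_smul, Submodule.coe_smul]
  rw [hN.hor_eq_leftTranslation h𝔭 hc hcov, hx]
  exact hadd _ _

theorem ver_cov_leftTranslation (hN : IsCosetManifold I J K) (h𝔭 : IsReductive I K 𝔭)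
    (hc : ∀ a : G, IsCompl (leftDistribution I 𝔭 a) (vertical I J (fun a : G ↦ (a : G ⧸ K)) a))
    (hG : IsCanonicalConnection I cov) (hu : MDifferentiableAt I 𝓘(ℝ, E) u a)
    (hx : X a = leftTranslation a x) :
    ver hc (fun g ↦ cov (fun g ↦ leftTranslation g (u g)) g (X g)) a =
      leftTranslation a
          (h𝔭.kPart (mvfderiv I u a (leftTranslation a x)) : GroupLieAlgebra I G) +
        leftTranslation a ((1 / 2 : ℝ) • (h𝔭.kPart ⁅x, u a⁆ : GroupLieAlgebra I G)) := by
  have : CompleteSpace E := FiniteDimensional.complete ℝ E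
  have hcov := (hG.cov_leftTranslation_apply hu x).trans
    (map_add (leftTranslation (I := I) a) _ _).symm
  rw [← hx] at hcov
  have hadd (v w : GroupLieAlgebra I G) :
      leftTranslation a (h𝔭.kPart (v + (1 / 2 : ℝ) • w) : GroupLieAlgebra I G) =
        leftTranslation a (h𝔭.kPart v : GroupLieAlgebra I G) +
          leftTranslation a ((1 / 2 : ℝ) • (h𝔭.kPart w : GroupLieAlgebra I G)) := by
    rw [map_add, Submodule.coe_add, map_add, map_smul, Submodule.coe_smul]
  rw [hN.ver_eq_leftTranslation h𝔭 hc hcov, hx]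
  exact hadd _ _

theorem isFundamentalTensor (hN : IsCosetManifold I J K) (h𝔭 : IsReductive I K 𝔭)
    (hc : ∀ a : G, IsCompl (leftDistribution I 𝔭 a) (vertical I J (fun a : G ↦ (a : G ⧸ K)) a))
    (hG : IsCanonicalConnection I cov) :
    have : CompleteSpace E := FiniteDimensional.complete ℝ E
    IsFundamentalTensor hc cov h𝔭.fundamentalTensor := by
  have : CompleteSpace E := FiniteDimensional.complete ℝ E
  have : LieGroup I (minSmoothness ℝ 3) G := lieGroup_minSmoothness
  intro _ X Y _ hY a
  let y (g : G) : E := (leftTranslation g).symm (Y g)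
  have hYy (g : G) : Y g = leftTranslation g (y g) := ((leftTranslation g).apply_symm_apply _).symm
  have hy : MDifferentiableAt I 𝓘(ℝ, E) y a :=
    mdifferentiableAt_leftTranslation_apply_iff.1
      (by simpa only [← hYy] using hY.mdifferentiableAt a)
  obtain ⟨x, hx⟩ := (leftTranslation a).surjective (X a)
  let p : E →ₗ[ℝ] E := 𝔭.subtype ∘ₗ h𝔭.pPart
  let k : E →ₗ[ℝ] E := (subgroupLieAlgebra I K).subtype ∘ₗ h𝔭.kPart
  have hp : MDifferentiableAt I 𝓘(ℝ, E) (fun g ↦ p (y g)) a :=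
    p.toContinuousLinearMap.mdifferentiableAt.comp a hy
  have hk : MDifferentiableAt I 𝓘(ℝ, E) (fun g ↦ k (y g)) a :=
    k.toContinuousLinearMap.mdifferentiableAt.comp a hy
  have hhorY : hor hc Y = fun g ↦ leftTranslation g (p (y g)) :=
    funext fun g ↦ hN.hor_eq_leftTranslation h𝔭 hc (hYy g)
  have hverY : ver hc Y = fun g ↦ leftTranslation g (k (y g)) :=
    funext fun g ↦ hN.ver_eq_leftTranslation h𝔭 hc (hYy g)
  have hhorX : hor hc X a = leftTranslation a (p x) := hN.hor_eq_leftTranslation h𝔭 hc hx.symm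
  have hdp := h𝔭.kPart_of_mem (mvfderiv_leftTranslation_mem (S := 𝔭) hp
    (fun g ↦ (h𝔭.pPart (y g)).2) (p x))
  have hdk := h𝔭.pPart_of_mem_subgroupLieAlgebra (mvfderiv_leftTranslation_mem
    (S := subgroupLieAlgebra I K) hk (fun g ↦ (h𝔭.kPart (y g)).2) (p x))
  rw [hhorY, hverY, hN.ver_cov_leftTranslation h𝔭 hc hG hp hhorX,
    hN.hor_cov_leftTranslation h𝔭 hc hG hk hhorX, hdp, hdk]
  simp only [ZeroMemClass.coe_zero, map_zero, zero_add]
  rw [← map_add, ← hx, hYy]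
  exact h𝔭.fundamentalTensor_leftTranslation a x (y a)

variable [IsManifold J ∞ (G ⧸ K)]

theorem mdifferentiableAt_horizontalLift (hN : IsCosetManifold I J K) (h𝔭 : IsReductive I K 𝔭)
    {Z : Π x : G ⧸ K, TangentSpace J x} (hZ : SmoothField J Z) (hu𝔭 : ∀ g, u g ∈ 𝔭)
    (hZu : ∀ g : G, Z g = mfderiv I J (fun a : G ↦ (a : G ⧸ K)) g (leftTranslation g (u g))) :
    MDifferentiableAt I 𝓘(ℝ, E) u a := by
  have : CompleteSpace E := FiniteDimensional.complete ℝ E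
  let 𝔭E : Submodule ℝ E := 𝔭
  let W (g : G) : 𝔭E →ₗ[ℝ] TangentSpace J (g : G ⧸ K) :=
    (mfderiv I J (fun a : G ↦ (a : G ⧸ K)) g).toLinearMap ∘ₗ
      (leftTranslation g).toLinearMap ∘ₗ 𝔭.subtype
  have htangentMap : ContMDiff I.tangent J.tangent ∞
      (tangentMap I J (fun a : G ↦ (a : G ⧸ K))) := hN.contMDiff_mk.contMDiff_tangentMap le_rfl
  have hcomponent : MDifferentiableAt I 𝓘(ℝ, 𝔭E) (fun g ↦ (⟨u g, hu𝔭 g⟩ : 𝔭E)) a := by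
    refine mdifferentiableAt_of_mdifferentiableAt_frame (I := J) (F := E')
      (V := (TangentSpace J : G ⧸ K → Type _)) (C := 𝔭E) (W := W)
      (.of_forall (hN.bijective_mfderiv_mk_leftTranslation h𝔭)) (fun X ↦ ?_) ?_
    · exact (htangentMap.comp (smoothField_mulInvariantVectorField X.1)).mdifferentiable
        (by simp) a
    · refine ((ContMDiff.comp hZ hN.contMDiff_mk).mdifferentiable (by simp) a).congr_of_eventuallyEq
        (.of_forall fun g ↦ ?_)
      exact congrArg (TotalSpace.mk' E' (g : G ⧸ K)) (hZu g).symm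
  exact 𝔭E.subtypeL.mdifferentiableAt.comp a hcomponent

theorem isAffineSubmersion [FiniteDimensional ℝ E'] (hN : IsCosetManifold I J K)
    (h𝔭 : IsReductive I K 𝔭)
    {covN : CovariantDerivative J E' (TangentSpace J : G ⧸ K → Type _)}
    (hG : IsCanonicalConnection I cov) (hcovN : IsNaturalTorsionFree J h𝔭 covN) :
    IsAffineSubmersion I J (fun a : G ↦ (a : G ⧸ K)) (leftDistribution I 𝔭) cov covN := by
  have : CompleteSpace E := FiniteDimensional.complete ℝ E
  have hc := hN.isCompl_leftDistribution_vertical h𝔭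
  refine ⟨hN.contMDiff_mk, hN.mfderiv_mk_surjective, isSmoothDistribution_leftDistribution, hc, ?_⟩
  intro X Z Xbar Zbar _ hZ hXbar hZbar a
  choose z hz𝔭 hz using fun g ↦ (hZbar g).1
  obtain ⟨x, hx𝔭, hx⟩ := (hXbar a).1
  have hZz (g : G) : Z g = mfderiv I J (fun a : G ↦ (a : G ⧸ K)) g (leftTranslation g (z g)) := by
    rw [← (hZbar g).2, ← hz g]
    rfl
  have hzd := hN.mdifferentiableAt_horizontalLift h𝔭 hZ hz𝔭 hZz (a := a)
  have hdz := mvfderiv_leftTranslation_mem hzd hz𝔭 x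
  have hcovZ := hcovN.cov_mk hN hx𝔭 hZ hz𝔭 hzd hZz
  have hcovZbar := hN.hor_cov_leftTranslation h𝔭 hc hG hzd (X := Xbar) hx.symm
  rw [show (fun g ↦ leftTranslation g (z g)) = Zbar from funext hz, h𝔭.pPart_of_mem hdz] at hcovZbar
  rw [show leftTranslation a x = Xbar a from hx] at hdz hcovZ hcovZbar
  rw [(hXbar a).2] at hcovZ
  rw [hcovZbar]
  exact ⟨Submodule.add_mem _ (Submodule.mem_map_of_mem hdz)
    (Submodule.mem_map_of_mem (𝔭.smul_mem _ (h𝔭.pPart _).2)), (map_add _ _ _).trans hcovZ.symm⟩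

end IsCosetManifold
end Projection

end AffineSubmersion

end

theorem mainTheorem7_general
    {E : Type*} [NormedAddCommGroup E] [NormedSpace ℝ E] [FiniteDimensional ℝ E]
    {H : Type*} [TopologicalSpace H] (I : ModelWithCorners ℝ E H)
    {G : Type*} [TopologicalSpace G] [T2Space G] [ChartedSpace H G] [Group G] [LieGroup I ∞ G]
    [BoundarylessManifold I G] (K : Subgroup G)
    {E' : Type*} [NormedAddCommGroup E'] [NormedSpace ℝ E'] [FiniteDimensional ℝ E']
    {H' : Type*} [TopologicalSpace H'] (J : ModelWithCorners ℝ E' H')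
    [ChartedSpace H' (G ⧸ K)] [IsManifold J ∞ (G ⧸ K)] (hN : IsCosetManifold I J K)
    (𝔭 : Submodule ℝ (GroupLieAlgebra I G)) (h𝔭 : IsReductive I K 𝔭)
    (covG : CovariantDerivative I E (TangentSpace I : G → Type _))
    (hG : IsCanonicalConnection I covG)
    (covN : CovariantDerivative J E' (TangentSpace J : G ⧸ K → Type _))
    (hcovN : IsNaturalTorsionFree J h𝔭 covN) :
    ∃ h : IsAffineSubmersion I J (fun a : G ↦ (a : G ⧸ K)) (leftDistribution I 𝔭) covG covN,
      ∃ A : Π a : G, TangentSpace I a →ₗ[ℝ] TangentSpace I a →ₗ[ℝ] TangentSpace I a,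
        IsFundamentalTensor h.isCompl covG A ∧
        (∀ (a : G), ∀ X ∈ 𝔭, ∀ Y ∈ 𝔭,
          A a (mulInvariantVectorField X a) (mulInvariantVectorField Y a) =
            mulInvariantVectorField
              ((1 / 2 : ℝ) • (h𝔭.kPart ⁅X, Y⁆ : GroupLieAlgebra I G)) a) ∧
        ∀ (a : G), ∀ x ∈ leftDistribution I 𝔭 a, A a x x = 0 := by
  have : CompleteSpace E := FiniteDimensional.complete ℝ E
  have haffine := hN.isAffineSubmersion h𝔭 hG hcovN
  exact ⟨haffine, h𝔭.fundamentalTensor, hN.isFundamentalTensor h𝔭 haffine.isCompl hG,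
    fun a _ hX _ hY ↦ h𝔭.fundamentalTensor_mulInvariantVectorField a hX hY,
    fun _ _ hx ↦ h𝔭.fundamentalTensor_self hx⟩

theorem mainTheorem7
    {E : Type*} [NormedAddCommGroup E] [NormedSpace ℝ E] [FiniteDimensional ℝ E]
    {G : Type*} [TopologicalSpace G] [T2Space G] [ConnectedSpace G] [ChartedSpace E G] [Group G]
    [LieGroup 𝓘(ℝ, E) ∞ G]
    (K : Subgroup G) (hK : IsClosed (K : Set G))
    {E' : Type*} [NormedAddCommGroup E'] [NormedSpace ℝ E'] [FiniteDimensional ℝ E']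
    [ChartedSpace E' (G ⧸ K)] [IsManifold 𝓘(ℝ, E') ∞ (G ⧸ K)]
    (hN : IsCosetManifold 𝓘(ℝ, E) 𝓘(ℝ, E') K)
    (𝔭 : Submodule ℝ (GroupLieAlgebra 𝓘(ℝ, E) G)) (h𝔭 : IsReductive 𝓘(ℝ, E) K 𝔭)
    (covG : CovariantDerivative 𝓘(ℝ, E) E (TangentSpace 𝓘(ℝ, E) : G → Type _))
    (hG : IsCanonicalConnection 𝓘(ℝ, E) covG)
    (covN : CovariantDerivative 𝓘(ℝ, E') E' (TangentSpace 𝓘(ℝ, E') : G ⧸ K → Type _))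
    (hcovN : IsNaturalTorsionFree 𝓘(ℝ, E') h𝔭 covN) :
    ∃ h : IsAffineSubmersion 𝓘(ℝ, E) 𝓘(ℝ, E') (fun a : G ↦ (a : G ⧸ K))
        (leftDistribution 𝓘(ℝ, E) 𝔭) covG covN,
      ∃ A : Π a : G, TangentSpace 𝓘(ℝ, E) a →ₗ[ℝ] TangentSpace 𝓘(ℝ, E) a →ₗ[ℝ]
          TangentSpace 𝓘(ℝ, E) a,
        IsFundamentalTensor h.isCompl covG A ∧
        (∀ (a : G), ∀ X ∈ 𝔭, ∀ Y ∈ 𝔭,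
          A a (mulInvariantVectorField X a) (mulInvariantVectorField Y a) =
            mulInvariantVectorField
              ((1 / 2 : ℝ) • (h𝔭.kPart ⁅X, Y⁆ : GroupLieAlgebra 𝓘(ℝ, E) G)) a) ∧
        ∀ (a : G), ∀ x ∈ leftDistribution 𝓘(ℝ, E) 𝔭 a, A a x x = 0 := by
  exact mainTheorem7_general 𝓘(ℝ, E) K 𝓘(ℝ, E') hN 𝔭 h𝔭 covG hG covN hcovN
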